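/- Let $\Omega\subset\mathbb{R}^3$ be open, and let $w\in C^\infty(\Omega;\mathbb{R}^3)$ and $\chi\in C^1(\Omega)$ satisfy $$w\times(\nabla\times w)=\nabla\chi,\qquad \nabla\cdot w=0\qquad\text{in }\Omega,$$ with $w\neq 0$ and $\nabla\times w\neq 0$ everywhere in $\Omega$. A smooth vector field $\xi$ is called a symmetry of $w$ in an open set $U$ if $\mathfrak{L}_\xi w=(\xi\cdot\nabla)w-(w\cdot\nabla)\xi=0$ in $U$, and a solenoidal symmetry if moreover $\nabla\cdot\xi=0$ in $U$. Then $w$ is locally symmetric, and the local symmetry can be chosen solenoidal and nontrivial. Precisely: (1) Every $x\in\Omega$ has an open neighborhood $U\subset\Omega$ with a solenoidal symmetry $\xi$ of $w$ in $U$ such that $\xi\neq 0$ everywhere in $U$, and such that $x$ is in the closure of $\{y\in U:\ w(y)\times\xi(y)\neq 0\}$ (so $\xi$ is not aligned with $w$ near $x$). (2) (Force-free case.) If $x\in\Omega$ and $\nabla\chi=0$ in a neighborhood of $x$, then there are an open neighborhood $U\subset\Omega$ of $x$ in which $\nabla\times w=\hat h\,w$ with $\hat h=w\cdot(\nabla\times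 w)/|w|^2$, and smooth curvilinear coordinates $(\ell,\psi,\theta)$ in $U$ (a diffeomorphism of $U$ onto its image, with coordinate tangent vectors $\partial_\ell,\partial_\psi,\partial_\theta$) such that $$w=\cos\theta\,\nabla\psi+\sin\theta\,\nabla\ell,\qquad \sin\theta\neq 0\qquad\text{in }U.$$ Put $L=\ell\cos\theta-\psi\sin\theta$. For every smooth function $g$ of two variables there are an open neighborhood $V\subset U$ of $x$ and a smooth function $\alpha$ on $V$ such that, writing $g$ for $g(L,\theta)$, where $\partial g/\partial L$ is the derivative in the first variable and $\partial g/\partial\theta$ is the derivative at fixed $\ell,\psi$, $$\xi=\hat h\left[\alpha\,\partial_\ell+\frac{\frac{\partial g}{\partial\theta}+\alpha\cos\theta}{\sin\theta}\,\partial_\psi+\frac{\partial g}{\partial L}\,\partial_\theta\right]$$ is a solenoidal symmetry of $w$ in $V$ with $w\times\xi=\nabla\big(g(L,\theta)\big)$ in $V$. If the differential of $g$ does not vanish at $(L(x),\theta(x))$, then $V$ and $\alpha$ can be chosen so that moreover $w\times\xi\neq 0$ everywhere in $V$; in particular $\xi$ is non-vanishing and nowhere aligned with $w$. (3) The field $\xi=\nabla\times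 w$ is a solenoidal symmetry of $w$ in all of $\Omega$, and $w\times\xi\neq0$ at every point where $\nabla\chi\neq 0$. -/

import Mathlib

open scoped ContDiff Topology

noncomputable section

namespace Magnetofluid

/-- Three-dimensional Euclidean space. -/
abbrev E3 : Type := EuclideanSpace ℝ (Fin 3)

/-- The cross product of Euclidean 3-vectors. -/
def cross (a b : E3) : E3 :=
  !₂[a 1 * b 2 - a 2 * b 1, a 2 * b 0 - a 0 * b 2, a 0 * b 1 - a 1 * b 0]

/-- The partial derivative `∂ vʲ / ∂ xⁱ` of a component of a vector field. -/
def partialD (i j : Fin 3) (v : E3 → E3) (x : E3) : ℝ :=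
  (fderiv ℝ v x (EuclideanSpace.single i 1)) j

/-- The curl of a vector field. -/
def curl (v : E3 → E3) (x : E3) : E3 :=
  !₂[partialD 1 2 v x - partialD 2 1 v x,
     partialD 2 0 v x - partialD 0 2 v x,
     partialD 0 1 v x - partialD 1 0 v x]

/-- The divergence of a vector field. -/
def div (v : E3 → E3) (x : E3) : ℝ := ∑ i, partialD i i v x

/-- `w × curl w = ∇χ` and `div w = 0` in `Ω`, with `w` and `χ` of class `C¹`. -/
structure SolvesMFF (Ω : Set E3) (w : E3 → E3) (χ : E3 → ℝ) : Prop where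
  contDiffOn_field : ContDiffOn ℝ 1 w Ω
  contDiffOn_pressure : ContDiffOn ℝ 1 χ Ω
  force_balance : ∀ x ∈ Ω, cross (w x) (curl w x) = gradient χ x
  solenoidal : ∀ x ∈ Ω, div w x = 0

/-- The smooth vector field `ξ` is a symmetry of the vector field `w` in `U`: the Lie derivative
`L_ξ w = (ξ · ∇) w - (w · ∇) ξ` vanishes in `U`. -/
structure IsSymmetryOn (U : Set E3) (ξ w : E3 → E3) : Prop where
  smooth : ContDiffOn ℝ ∞ ξ U
  lie_eq_zero : ∀ x ∈ U, VectorField.lieBracket ℝ ξ w x = 0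

/-- `ξ` is a solenoidal symmetry of `w` in `U`. -/
structure IsSolenoidalSymmetryOn (U : Set E3) (ξ w : E3 → E3) : Prop extends
    IsSymmetryOn U ξ w where
  solenoidal : ∀ x ∈ U, div ξ x = 0

/-- The triple product `∇a · (∇b × ∇c)`, the Jacobian determinant of `x ↦ (a, b, c)`. -/
def jacobian (a b c : E3 → ℝ) (x : E3) : ℝ :=
  inner ℝ (gradient a x) (cross (gradient b x) (gradient c x))

/-- The coordinate tangent vector `∂_a` of a curvilinear coordinate system `(a, b, c)`, that is
the vector with `∂_a · ∇a = 1` and `∂_a · ∇b = ∂_a · ∇c = 0`. -/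
def tangentVec (a b c : E3 → ℝ) (x : E3) : E3 :=
  (jacobian a b c x)⁻¹ • cross (gradient b x) (gradient c x)

/-- `(ℓ, ψ, θ)` are smooth curvilinear coordinates in `U`, that is, a diffeomorphism of `U` onto
its image. -/
structure IsCurvilinear (U : Set E3) (l ψ θ : E3 → ℝ) : Prop where
  smooth_l : ContDiffOn ℝ ∞ l U
  smooth_psi : ContDiffOn ℝ ∞ ψ U
  smooth_theta : ContDiffOn ℝ ∞ θ U
  injOn : Set.InjOn (fun x => (l x, ψ x, θ x)) U
  jacobian_ne_zero : ∀ x ∈ U, jacobian l ψ θ x ≠ 0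

/-- `(ℓ, ψ, θ)` are Beltrami (Lie–Darboux) coordinates for `w` in `U`:
`w = cos θ ∇ψ + sin θ ∇ℓ`. -/
structure IsBeltramiCoord (U : Set E3) (w : E3 → E3) (l ψ θ : E3 → ℝ) : Prop extends
    IsCurvilinear U l ψ θ where
  representation : ∀ x ∈ U,
    w x = Real.cos (θ x) • gradient ψ x + Real.sin (θ x) • gradient l x

/-- The proportionality coefficient `ĥ = (w · curl w) / |w|²` of a Beltrami field. -/
def beltramiCoeff (w : E3 → E3) (x : E3) : ℝ :=
  inner ℝ (w x) (curl w x) / ‖w x‖ ^ 2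

/-- The point `(L, θ)`, where `L = ℓ cos θ - ψ sin θ`. -/
def labels (l ψ θ : E3 → ℝ) (x : E3) : ℝ × ℝ :=
  (l x * Real.cos (θ x) - ψ x * Real.sin (θ x), θ x)

/-- For `g = g(L, θ)`, the partial derivative of `g` in its first argument. -/
def gL (g : ℝ × ℝ → ℝ) (l ψ θ : E3 → ℝ) (x : E3) : ℝ :=
  fderiv ℝ g (labels l ψ θ x) (1, 0)

/-- For `g = g(L, θ)`, the derivative in `θ` at fixed `ℓ` and `ψ`; by the chain rule it collects
the contribution `∂L/∂θ = -ℓ sin θ - ψ cos θ`. -/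
def gTheta (g : ℝ × ℝ → ℝ) (l ψ θ : E3 → ℝ) (x : E3) : ℝ :=
  fderiv ℝ g (labels l ψ θ x) (-(l x * Real.sin (θ x)) - ψ x * Real.cos (θ x), 1)

/-- The vector field
`ξ = ĥ [α ∂_ℓ + ((∂g/∂θ + α cos θ) / sin θ) ∂_ψ + (∂g/∂L) ∂_θ]`. -/
def beltramiSymmetry (w : E3 → E3) (l ψ θ : E3 → ℝ) (g : ℝ × ℝ → ℝ) (α : E3 → ℝ)
    (x : E3) : E3 :=
  beltramiCoeff w x •
    (α x • tangentVec l ψ θ x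
      + ((gTheta g l ψ θ x + α x * Real.cos (θ x)) / Real.sin (θ x)) • tangentVec ψ θ l x
      + gL g l ψ θ x • tangentVec θ l ψ x)

end Magnetofluid

end

/-! The identity curl (a × b) = [b, a] + (div b) a - (div a) b shows that two solenoidal fields
commute as soon as their cross product is a gradient (`lieBracket_eq_zero_of_cross_eq_gradient`). As
div w = 0 and w × curl w = ∇χ, the field curl w is therefore a solenoidal symmetry. It is not
aligned with w where ∇χ ≠ 0, so a different symmetry is needed only near points around which ∇χ
vanishes identically.

Near such a point curl w = ĥ w, and it suffices to find a solenoidal ξ with w × ξ a nonzero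
gradient. Straightening the nonvanishing field curl w gives w = ∇z - L ∇θ (`exists_darboux_form`);
rotating the pair (L, z) by the angle θ turns this into w = cos θ ∇ψ + sin θ ∇ℓ. The Jacobian of (ℓ,
ψ, θ) equals w · curl w = ĥ |w|², which is nonzero, so these functions are coordinates. In them w is
a multiple of sin θ ∂_ℓ + cos θ ∂_ψ, which annihilates both L and θ. Hence every ∇g(L, θ) is
orthogonal to w and has the form w × ξ, with ξ determined up to a multiple β w. The parameter α
encodes β, and div ξ = 0 becomes a transport equation for β along w, which is locally solvable
(`exists_beltramiSymmetry`).

Both the normal form and the transport equation rest on the flow-box theorem, hence on smooth local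
flows. These come from the inverse function theorem in the Banach space of continuous paths, applied
to the integral equation γ = x + τ ∫ f ∘ γ, once γ ↦ f ∘ γ is known to be smooth. -/

noncomputable section

namespace Magnetofluid

/-! ### Smoothness of composition operators on spaces of continuous maps. -/

section Superposition

/-- The superposition operator `γ ↦ f ∘ γ` between spaces of continuous functions. -/
def superposition (K : Type*) [TopologicalSpace K] {E F : Type*} [TopologicalSpace E]
    [TopologicalSpace F] (f : E → F) (hf : Continuous f) (γ : C(K, E)) : C(K, F) :=
  (ContinuousMap.mk f hf).comp γ

/-- Pointwise application `C(K, E →L F) → C(K, E) → C(K, F)`. -/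
def pointwiseApply (K : Type*) [TopologicalSpace K] [CompactSpace K] (E F : Type*)
    [NormedAddCommGroup E] [NormedSpace ℝ E] [NormedAddCommGroup F] [NormedSpace ℝ F] :
    C(K, E →L[ℝ] F) →L[ℝ] C(K, E) →L[ℝ] C(K, F) :=
  LinearMap.mkContinuous₂
    (LinearMap.mk₂ ℝ
      (fun (A : C(K, E →L[ℝ] F)) (h : C(K, E)) =>
        (⟨fun t => A t (h t), A.continuous.clm_apply h.continuous⟩ : C(K, F)))
      (fun _ _ _ => by ext; simp) (fun _ _ _ => by ext; simp)
      (fun _ _ _ => by ext; simp) (fun _ _ _ => by ext; simp)) 1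
    (fun A h => by
      change ‖(⟨fun t => A t (h t), _⟩ : C(K, F))‖ ≤ _
      rw [ContinuousMap.norm_le _ (by positivity)]
      intro t
      rw [one_mul]
      exact (A t).le_of_opNorm_le_of_le (A.norm_coe_le_norm t) (h.norm_coe_le_norm t))

lemma continuous_superposition {K : Type*} [TopologicalSpace K] {E F : Type*} [TopologicalSpace E]
    [TopologicalSpace F] (f : E → F) (hf : Continuous f) :
    Continuous (superposition K f hf) :=
  ContinuousMap.continuous_postcomp _

/-- The mean value inequality is applied at each parameter `t` separately. Uniformity in `t` comes
from the continuity, in the sup norm, of superposition with `fderiv ℝ f`. -/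
lemma hasFDerivAt_superposition {K : Type*} [TopologicalSpace K] [CompactSpace K] {E F : Type*}
    [NormedAddCommGroup E] [NormedSpace ℝ E] [NormedAddCommGroup F] [NormedSpace ℝ F]
    (f : E → F) (hf : ContDiff ℝ 1 f) (γ : C(K, E)) :
    HasFDerivAt (superposition K f hf.continuous)
      (pointwiseApply K E F
        (superposition K (fderiv ℝ f) (hf.continuous_fderiv one_ne_zero) γ)) γ := by
  have hc := hf.continuous_fderiv one_ne_zero
  rw [hasFDerivAt_iff_isLittleO_nhds_zero, Asymptotics.isLittleO_iff]
  intro ε hε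
  obtain ⟨δ, hδ, hd⟩ := (Metric.continuous_iff (α := C(K, E)) (β := C(K, E →L[ℝ] F))).1
    (continuous_superposition (K := K) (fderiv ℝ f) hc) γ ε hε
  have hpt : ∀ t : K, ∀ y ∈ Metric.ball (γ t) δ, ‖fderiv ℝ f y - fderiv ℝ f (γ t)‖ ≤ ε := by
    intro t y hy
    -- Shifting `γ` by a constant path moves its value at `t` to `y` at sup distance `‖y - γ t‖`, so
    -- the estimate between paths yields one between points.
    have h1 : dist (γ + ContinuousMap.const K (y - γ t)) γ < δ := by
      rw [dist_eq_norm, add_sub_cancel_left]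
      refine lt_of_le_of_lt ((ContinuousMap.norm_le _ (norm_nonneg (y - γ t))).2
        fun s => by simp) ?_
      rwa [← dist_eq_norm]
    have h2 := (ContinuousMap.dist_apply_le_dist t).trans_lt (hd _ h1)
    rw [dist_eq_norm] at h2
    have h3 : γ t + (y - γ t) = y := by abel
    simpa [superposition, h3] using h2.le
  filter_upwards [Metric.ball_mem_nhds (0 : C(K, E)) hδ] with h hh
  rw [ContinuousMap.norm_le _ (by positivity)]
  intro t
  have hht : ‖h t‖ < δ := (h.norm_coe_le_norm t).trans_lt (by simpa using hh)
  have := (convex_ball (γ t) δ).norm_image_sub_le_of_norm_fderiv_le' (𝕜 := ℝ)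
    (f := f) (φ := fderiv ℝ f (γ t)) (C := ε)
    (fun x _ => hf.differentiable one_ne_zero x) (hpt t)
    (Metric.mem_ball_self hδ) (y := γ t + h t) (by simpa using hht)
  rw [add_sub_cancel_left] at this
  refine this.trans ?_
  gcongr
  exact h.norm_coe_le_norm t

/-- The derivative is again a superposition operator, that of `fderiv ℝ f`, followed by a bounded
linear map. The spaces are quantified inside the induction because the target changes from `F` to `E
→L[ℝ] F`. -/
lemma contDiff_nat_superposition {K : Type} [TopologicalSpace K] [CompactSpace K] (n : ℕ) :
    ∀ {E F : Type}
    [NormedAddCommGroup E] [NormedSpace ℝ E] [NormedAddCommGroup F] [NormedSpace ℝ F]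
    (f : E → F) (hf : ContDiff ℝ ∞ f), ContDiff ℝ n (superposition K f hf.continuous) := by
  induction n with
  | zero =>
    intro E F _ _ _ _ f hf
    exact contDiff_zero.2 (continuous_superposition f hf.continuous)
  | succ n ih =>
    intro E F _ _ _ _ f hf
    have hf' : ContDiff ℝ ∞ (fderiv ℝ f) := (contDiff_infty_iff_fderiv.1 hf).2
    refine contDiff_succ_iff_hasFDerivAt.2 ⟨_, ?_, fun γ =>
      hasFDerivAt_superposition f (hf.of_le (by simp)) γ⟩
    exact (pointwiseApply K E F).contDiff.comp (ih (fderiv ℝ f) hf')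

lemma contDiff_superposition {K : Type} [TopologicalSpace K] [CompactSpace K] {E F : Type}
    [NormedAddCommGroup E] [NormedSpace ℝ E] [NormedAddCommGroup F] [NormedSpace ℝ F]
    (f : E → F) (hf : ContDiff ℝ ∞ f) : ContDiff ℝ ∞ (superposition K f hf.continuous) :=
  contDiff_infty.2 fun n => contDiff_nat_superposition n f hf

end Superposition

/-! ### Smooth local inverses and global representatives of smooth germs. -/

section Germs

/-- The inverse function theorem, with smoothness of the inverse on a whole neighbourhood. -/
lemma exists_smooth_localInverse {E F : Type*}
    [NormedAddCommGroup E] [NormedSpace ℝ E] [CompleteSpace E]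
    [NormedAddCommGroup F] [NormedSpace ℝ F]
    (f : E → F) (hf : ContDiff ℝ ∞ f) (a : E) (A : E ≃L[ℝ] F)
    (hA : HasFDerivAt f (A : E →L[ℝ] F) a) :
    ∃ g : F → E, g (f a) = a ∧ (∀ᶠ y in 𝓝 (f a), ContDiffAt ℝ ∞ g y) ∧
      (∀ᶠ x in 𝓝 a, g (f x) = x) ∧ ∀ᶠ y in 𝓝 (f a), f (g y) = y := by
  have h0 : (∞ : WithTop ℕ∞) ≠ 0 := by simp
  set e := hf.contDiffAt.toOpenPartialHomeomorph f hA h0 with he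
  have hs : a ∈ e.source := hf.contDiffAt.mem_toOpenPartialHomeomorph_source hA h0
  have hef : (e : E → F) = f := rfl
  have ht : f a ∈ e.target := e.map_source hs
  have hga : e.symm (f a) = a := e.left_inv hs
  refine ⟨e.symm, hga, ?_, ?_, ?_⟩
  · have hcont : ContinuousAt (fun y => fderiv ℝ f (e.symm y)) (f a) :=
      (hf.continuous_fderiv (by simp)).continuousAt.comp (e.continuousAt_symm ht)
    -- Invertible operators form an open set, so the derivative stays invertible near `a` and the
    -- inverse is smooth at every nearby point.
    have hn : Set.range ((↑) : (E ≃L[ℝ] F) → E →L[ℝ] F) ∈ 𝓝 (fderiv ℝ f (e.symm (f a))) := by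
      rw [hga, hA.fderiv]
      exact ContinuousLinearEquiv.nhds A
    filter_upwards [hcont hn, e.open_target.mem_nhds ht] with y hy hyt
    obtain ⟨B, hB⟩ := hy
    refine e.contDiffAt_symm (f₀' := B) hyt ?_ hf.contDiffAt
    rw [hB, hef]
    exact (hf.differentiable (by simp) _).hasFDerivAt
  · filter_upwards [e.open_source.mem_nhds hs] with x hx using e.left_inv hx
  · filter_upwards [e.open_target.mem_nhds ht] with y hy using e.right_inv hy

/-- A map which is smooth near a point agrees near this point with a globally smooth map. -/
lemma exists_contDiff_eventuallyEq {E F : Type*}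
    [NormedAddCommGroup E] [NormedSpace ℝ E] [FiniteDimensional ℝ E]
    [NormedAddCommGroup F] [NormedSpace ℝ F] {f : E → F} {x : E}
    (hf : ∀ᶠ y in 𝓝 x, ContDiffAt ℝ ∞ f y) :
    ∃ g : E → F, ContDiff ℝ ∞ g ∧ g =ᶠ[𝓝 x] f := by
  obtain ⟨r, hr, hrf⟩ := Metric.eventually_nhds_iff_ball.1 hf
  -- The outer radius `r / 2` keeps the closed support inside the ball of radius `r` on which `f` is
  -- smooth.
  let φ : ContDiffBump x := ⟨r / 4, r / 2, by positivity, by linarith⟩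
  refine ⟨fun y => φ y • f y, ?_, ?_⟩
  · rw [contDiff_iff_contDiffAt]
    intro y
    by_cases hy : y ∈ tsupport φ
    · rw [φ.tsupport_eq] at hy
      refine φ.contDiff.contDiffAt.smul (hrf y ?_)
      exact Metric.closedBall_subset_ball (by simp [φ]; linarith) hy
    · have : (fun y => φ y • f y) =ᶠ[𝓝 y] fun _ => 0 := by
        filter_upwards [notMem_tsupport_iff_eventuallyEq.1 hy] with z hz
        simp [hz]
      exact contDiffAt_const.congr_of_eventuallyEq this
  · filter_upwards [φ.eventuallyEq_one] with y hy
    simp [hy]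

end Germs

/-! ### Integral curves from the inverse function theorem. -/

section Flow

open unitInterval

/-- The primitive vanishing at `0`, as an operator on continuous paths. -/
def primitive (E : Type*) [NormedAddCommGroup E] [NormedSpace ℝ E] : C(I, E) →L[ℝ] C(I, E) :=
  LinearMap.mkContinuous
    { toFun := fun γ => (⟨fun s => ∫ r in (0 : ℝ)..s, γ (Set.projIcc 0 1 zero_le_one r),
        (intervalIntegral.continuous_primitive (fun _ _ =>
          (γ.continuous.comp continuous_projIcc).intervalIntegrable _ _) 0).comp
          continuous_subtype_val⟩ : C(I, E))
      map_add' := fun γ η => by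
        ext s
        exact intervalIntegral.integral_add
          ((γ.continuous.comp continuous_projIcc).intervalIntegrable _ _)
          ((η.continuous.comp continuous_projIcc).intervalIntegrable _ _)
      map_smul' := fun c γ => by
        ext s
        exact intervalIntegral.integral_smul _ _ } 1
    (fun γ => by
      rw [ContinuousMap.norm_le _ (by positivity)]
      intro s
      refine (intervalIntegral.norm_integral_le_of_norm_le_const
        fun r _ => γ.norm_coe_le_norm _).trans ?_
      rw [one_mul, sub_zero, abs_of_nonneg s.2.1]
      exact mul_le_of_le_one_right (norm_nonneg _) s.2.2)

lemma primitive_apply {E : Type*} [NormedAddCommGroup E] [NormedSpace ℝ E] (γ : C(I, E)) (s : I) :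
    primitive E γ s = ∫ r in (0 : ℝ)..s, γ (Set.projIcc 0 1 zero_le_one r) := rfl

variable {E : Type} [NormedAddCommGroup E] [NormedSpace ℝ E]

/-- The defect of the integral equation `γ = x + τ ∫ f ∘ γ`. -/
def integralDefect (f : E → E) (hf : Continuous f) (q : (E × ℝ) × C(I, E)) : C(I, E) :=
  q.2 - ContinuousLinearMap.const ℝ I q.1.1 - q.1.2 • primitive E (superposition I f hf q.2)

/-- Time is rescaled to `[0, 1]`, so the duration `τ` becomes a parameter. At `τ = 0` the defect has
the identity as its derivative in the path, so the inverse function theorem gives existence, smooth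
dependence and local uniqueness together. -/
lemma exists_integral_curves [CompleteSpace E] (f : E → E) (hf : ContDiff ℝ ∞ f) (x₀ : E) :
    ∃ Γ : E × ℝ → C(I, E), Γ (x₀, 0) = ContinuousLinearMap.const ℝ I x₀ ∧
      (∀ᶠ p in 𝓝 (x₀, (0 : ℝ)), ContDiffAt ℝ ∞ Γ p) ∧
      (∀ᶠ p in 𝓝 (x₀, (0 : ℝ)), integralDefect f hf.continuous (p, Γ p) = 0) ∧
      ∀ᶠ q in 𝓝 ((x₀, (0 : ℝ)), ContinuousLinearMap.const ℝ I x₀),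
        integralDefect f hf.continuous q = 0 → q.2 = Γ q.1 := by
  set γ₀ : C(I, E) := ContinuousLinearMap.const ℝ I x₀ with hγ₀
  set a : (E × ℝ) × C(I, E) := ((x₀, 0), γ₀) with ha
  have hS := contDiff_superposition (K := I) f hf
  let H : (E × ℝ) × C(I, E) → (E × ℝ) × C(I, E) :=
    fun q => (q.1, integralDefect f hf.continuous q)
  have hP : ContDiff ℝ ∞ fun q : (E × ℝ) × C(I, E) =>
      primitive E (superposition I f hf.continuous q.2) :=
    (primitive E).contDiff.comp (hS.comp contDiff_snd)
  have hD : ContDiff ℝ ∞ (integralDefect f hf.continuous) := by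
    refine (contDiff_snd.sub ((ContinuousLinearMap.const ℝ I).contDiff.comp
      (contDiff_fst.comp contDiff_fst))).sub ((contDiff_snd.comp contDiff_fst).smul hP)
  have hH : ContDiff ℝ ∞ H := contDiff_fst.prodMk hD
  let B : E × ℝ →L[ℝ] C(I, E) :=
    (ContinuousLinearMap.const ℝ I).comp (ContinuousLinearMap.fst ℝ E ℝ) +
      (ContinuousLinearMap.snd ℝ E ℝ).smulRight
        (primitive E (superposition I f hf.continuous γ₀))
  -- The derivative `(p, γ) ↦ (p, γ - B p)` is triangular with identity diagonal, hence invertible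
  -- whatever `B` is.
  let A : ((E × ℝ) × C(I, E)) ≃L[ℝ] ((E × ℝ) × C(I, E)) :=
    ContinuousLinearEquiv.skewProd (.refl ℝ _) (.refl ℝ _) (-B)
  have hA : HasFDerivAt H (A : ((E × ℝ) × C(I, E)) →L[ℝ] _) a := by
    have h1 := (((ContinuousLinearMap.snd ℝ (E × ℝ) C(I, E)).hasFDerivAt (x := a)).sub
      (((ContinuousLinearMap.const ℝ I).comp ((ContinuousLinearMap.fst ℝ E ℝ).comp
        (ContinuousLinearMap.fst ℝ (E × ℝ) C(I, E)))).hasFDerivAt)).sub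
      (((ContinuousLinearMap.snd ℝ E ℝ).comp
        (ContinuousLinearMap.fst ℝ (E × ℝ) C(I, E))).hasFDerivAt.smul
        (hP.differentiable (by simp) a).hasFDerivAt)
    refine ((ContinuousLinearMap.fst ℝ (E × ℝ) C(I, E)).hasFDerivAt.prodMk h1).congr_fderiv ?_
    ext <;> simp [A, B, a]
  have hHa : H a = ((x₀, 0), 0) := by
    ext <;> simp [H, a, integralDefect, hγ₀]
  obtain ⟨g, hga, hg, hl, hr⟩ := exists_smooth_localInverse H hH a A hA
  rw [hHa] at hga hg hr
  have hc : Filter.Tendsto (fun p : E × ℝ => (p, (0 : C(I, E)))) (𝓝 (x₀, 0))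
      (𝓝 ((x₀, 0), 0)) := (Continuous.prodMk_left (0 : C(I, E))).continuousAt
  have hp : ∀ᶠ p in 𝓝 (x₀, (0 : ℝ)), H (g (p, 0)) = (p, 0) := hc.eventually hr
  refine ⟨fun p => (g (p, 0)).2, congrArg Prod.snd hga, ?_, ?_, ?_⟩
  · filter_upwards [hc.eventually hg] with p hgp
    exact contDiff_snd.contDiffAt.comp p
      (ContDiffAt.comp p hgp (contDiff_prodMk_left (0 : C(I, E))).contDiffAt)
  · filter_upwards [hp] with p hp
    have h1 : (g (p, 0)).1 = p := congrArg Prod.fst hp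
    have h2 := congrArg Prod.snd hp
    have h3 : (p, (g (p, 0)).2) = g (p, 0) := Prod.ext h1.symm rfl
    rw [h3]; exact h2
  · filter_upwards [hl] with q hq h0
    have : H q = (q.1, 0) := Prod.ext rfl h0
    rw [← this, hq]

end Flow

/-! ### The smooth local flow of a vector field. -/

section Flow

open unitInterval

variable {E : Type} [NormedAddCommGroup E] [NormedSpace ℝ E]

lemma eq_of_integralDefect_eq_zero {f : E → E} {hf : Continuous f} {p : E × ℝ} {γ : C(I, E)}
    (h : integralDefect f hf (p, γ) = 0) (s : I) :
    γ s = p.1 + p.2 • ∫ r in (0 : ℝ)..s, f (γ (Set.projIcc 0 1 zero_le_one r)) := by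
  have h1 := DFunLike.congr_fun h s
  simp only [integralDefect, ContinuousMap.sub_apply, ContinuousMap.smul_apply,
    primitive_apply, ContinuousMap.zero_apply] at h1
  rw [sub_sub, sub_eq_zero] at h1
  exact h1

/-- The path `s ↦ γ (κ s)`. -/
def rescale (κ : I) (γ : C(I, E)) : C(I, E) := γ.comp ⟨fun s => κ * s, by fun_prop⟩

/-- The substitution `r ↦ κ r` makes an initial piece of a solution of duration `τ` a solution of
duration `κ τ`. Together with local uniqueness, this identifies the endpoint at time `κ τ` with the
value at `κ` of one fixed path. -/
lemma integralDefect_rescale {f : E → E} {hf : Continuous f} {x : E} {τ : ℝ} {γ : C(I, E)}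
    (h : integralDefect f hf ((x, τ), γ) = 0) (κ : I) :
    integralDefect f hf ((x, (κ : ℝ) * τ), rescale κ γ) = 0 := by
  ext s
  simp only [integralDefect, ContinuousMap.sub_apply, ContinuousMap.smul_apply,
    primitive_apply, ContinuousMap.zero_apply]
  rw [sub_sub, sub_eq_zero]
  change γ (κ * s) = x + _
  rw [eq_of_integralDefect_eq_zero h (κ * s), mul_comm (κ : ℝ) τ, mul_smul]
  congr 2
  have h1 : ∫ r in (0 : ℝ)..s, superposition I f hf (rescale κ γ) (Set.projIcc 0 1 zero_le_one r)
      = ∫ r in (0 : ℝ)..s, f (γ (Set.projIcc 0 1 zero_le_one ((κ : ℝ) * r))) := by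
    refine intervalIntegral.integral_congr fun r hr => ?_
    rw [Set.uIcc_of_le s.2.1] at hr
    have hr1 : r ∈ Set.Icc (0 : ℝ) 1 := ⟨hr.1, hr.2.trans s.2.2⟩
    change f (γ (κ * Set.projIcc 0 1 zero_le_one r)) = _
    congr 2
    rw [Set.projIcc_of_mem _ hr1]
    exact (Set.projIcc_val zero_le_one (κ * ⟨r, hr1⟩ : I)).symm
  rw [h1, intervalIntegral.smul_integral_comp_mul_left
    (fun r => f (γ (Set.projIcc 0 1 zero_le_one r)))]
  simp

/-- Smooth vector fields have smooth local flows. -/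
theorem exists_smooth_flow [CompleteSpace E] (f : E → E) (hf : ContDiff ℝ ∞ f) (x₀ : E) :
    ∃ φ : E × ℝ → E, (∀ᶠ p in 𝓝 (x₀, (0 : ℝ)), ContDiffAt ℝ ∞ φ p) ∧
      (∀ᶠ p in 𝓝 (x₀, (0 : ℝ)), HasDerivAt (fun t => φ (p.1, t)) (f (φ p)) p.2) ∧
      ∀ᶠ x in 𝓝 x₀, φ (x, 0) = x := by
  obtain ⟨Γ, hΓ0, hΓ, hsol, huniq⟩ := exists_integral_curves f hf x₀
  have hcont : ContinuousAt Γ (x₀, 0) := hΓ.self_of_nhds.continuousAt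
  rw [nhds_prod_eq, Filter.eventually_prod_iff] at huniq
  obtain ⟨P, hP, Q, hQ, hPQ⟩ := huniq
  obtain ⟨δ, hδ, hQδ⟩ := Metric.eventually_nhds_iff_ball.1 hQ
  have hclose : ∀ᶠ p in 𝓝 (x₀, (0 : ℝ)),
      Γ p ∈ Metric.ball (ContinuousLinearMap.const ℝ I x₀) δ := by
    refine hcont.eventually ?_
    rw [hΓ0]
    exact Metric.ball_mem_nhds _ hδ
  obtain ⟨ε, hε, hall⟩ := Metric.eventually_nhds_iff_ball.1
    (hΓ.and (hsol.and (hP.and hclose)))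
  have hscale : ∀ x τ, (x, τ) ∈ Metric.ball (x₀, (0 : ℝ)) ε → ∀ κ : I,
      (x, (κ : ℝ) * τ) ∈ Metric.ball (x₀, (0 : ℝ)) ε := by
    intro x τ hxτ κ
    rw [Metric.mem_ball, Prod.dist_eq, max_lt_iff] at hxτ ⊢
    refine ⟨hxτ.1, lt_of_le_of_lt ?_ hxτ.2⟩
    simp only [dist_zero_right, norm_mul]
    exact mul_le_of_le_one_left (norm_nonneg _) (by simpa [abs_of_nonneg κ.2.1] using κ.2.2)
  have hresc : ∀ x τ, (x, τ) ∈ Metric.ball (x₀, (0 : ℝ)) ε → ∀ κ : I,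
      Γ (x, (κ : ℝ) * τ) 1 = Γ (x, τ) κ := by
    intro x τ hxτ κ
    obtain ⟨-, h2, -, h4⟩ := hall _ hxτ
    -- Rescaling only restricts the range of the path, so it stays in the neighbourhood where
    -- solutions are unique.
    have h5 : rescale κ (Γ (x, τ)) ∈ Metric.ball (ContinuousLinearMap.const ℝ I x₀) δ := by
      refine lt_of_le_of_lt ((ContinuousMap.dist_le dist_nonneg).2 fun s => ?_) h4
      exact ContinuousMap.dist_apply_le_dist (f := Γ (x, τ))
        (g := ContinuousLinearMap.const ℝ I x₀) (κ * s)
    have := hPQ (hall _ (hscale x τ hxτ κ)).2.2.1 (hQδ _ h5) (integralDefect_rescale h2 κ)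
    have h6 : rescale κ (Γ (x, τ)) 1 = Γ (x, (κ : ℝ) * τ) 1 := DFunLike.congr_fun this 1
    rw [← h6]
    change Γ (x, τ) (κ * 1) = _
    rw [mul_one]
  have hsmooth : ∀ p ∈ Metric.ball (x₀, (0 : ℝ)) ε, ContDiffAt ℝ ∞ (fun p => Γ p 1) p := by
    intro p hp
    exact (ContinuousMap.evalCLM ℝ (1 : I)).contDiff.contDiffAt.comp p (hall p hp).1
  refine ⟨fun p => Γ p 1, ?_, ?_, ?_⟩
  · filter_upwards [Metric.ball_mem_nhds (x₀, (0 : ℝ)) hε] with p hp using hsmooth p hp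
  · filter_upwards [Metric.ball_mem_nhds (x₀, (0 : ℝ)) hε] with p hp
    obtain ⟨x, t⟩ := p
    obtain ⟨hx, ht⟩ : dist x x₀ < ε ∧ |t| < ε := by
      simpa [Prod.dist_eq, max_lt_iff] using hp
    -- Halfway between `t` and `±ε`, on the same side of `0`, lies a nonzero `τ`. Thus `t` is an
    -- intermediate time of the path of duration `τ`, including when `t = 0`.
    obtain ⟨τ, κ, hτ, hτ0, rfl⟩ : ∃ (τ : ℝ) (κ : I), |τ| < ε ∧ τ ≠ 0 ∧ t = κ * τ := by
      rcases le_total 0 t with h0 | h0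
      · rw [abs_of_nonneg h0] at ht
        refine ⟨(t + ε) / 2, ⟨t / ((t + ε) / 2), by positivity, ?_⟩, ?_, by positivity, ?_⟩
        · exact (div_le_one (by positivity)).2 (by linarith)
        · rw [abs_of_nonneg (by positivity)]; linarith
        · exact (div_mul_cancel₀ _ (by positivity)).symm
      · rw [abs_of_nonpos h0] at ht
        have hneg : (t - ε) / 2 < 0 := by linarith
        refine ⟨(t - ε) / 2, ⟨t / ((t - ε) / 2), div_nonneg_of_nonpos h0 hneg.le, ?_⟩, ?_,
          hneg.ne, ?_⟩
        · exact (div_le_one_of_neg hneg).2 (by linarith)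
        · rw [abs_of_neg hneg]; linarith
        · exact (div_mul_cancel₀ _ hneg.ne).symm
    have hball : (x, τ) ∈ Metric.ball (x₀, (0 : ℝ)) ε := by
      simpa [Prod.dist_eq, max_lt_iff] using ⟨hx, hτ⟩
    have hd : HasDerivAt (fun t => Γ (x, t) 1) (deriv (fun t => Γ (x, t) 1) (κ * τ)) (κ * τ) := by
      have h1 := (hsmooth _ hp).differentiableAt (by simp)
      have h2 : DifferentiableAt ℝ (fun t : ℝ => (x, t)) ((κ : ℝ) * τ) := by fun_prop
      exact (DifferentiableAt.comp ((κ : ℝ) * τ) h1 h2).hasDerivAt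
    have hd1 : HasDerivAt (fun s : ℝ => Γ (x, s * τ) 1)
        (τ • deriv (fun t => Γ (x, t) 1) (κ * τ)) κ :=
      HasDerivAt.scomp (h := fun s : ℝ => s * τ) (g₁ := fun t => Γ (x, t) 1) (κ : ℝ) hd
        (by simpa using (hasDerivAt_id (κ : ℝ)).mul_const τ)
    have hcf : Continuous fun r : ℝ => f (Γ (x, τ) (Set.projIcc 0 1 zero_le_one r)) :=
      hf.continuous.comp ((Γ (x, τ)).continuous.comp continuous_projIcc)
    have hd2 : HasDerivAt (fun s : ℝ => x + τ • ∫ r in (0 : ℝ)..s,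
        f (Γ (x, τ) (Set.projIcc 0 1 zero_le_one r))) (τ • f (Γ (x, τ) κ)) κ := by
      have := (hcf.integral_hasStrictDerivAt 0 (κ : ℝ)).hasDerivAt
      simp only [Set.projIcc_val] at this
      exact (this.const_smul τ).const_add x
    have heq : Set.EqOn (fun s : ℝ => Γ (x, s * τ) 1) (fun s : ℝ => x + τ • ∫ r in (0 : ℝ)..s,
        f (Γ (x, τ) (Set.projIcc 0 1 zero_le_one r))) (Set.Icc 0 1) := by
      intro s hs
      have h1 := hresc x τ hball ⟨s, hs⟩
      have h2 := eq_of_integralDefect_eq_zero (hall _ hball).2.1 ⟨s, hs⟩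
      exact h1.trans h2
    -- The two functions agree only on `[0, 1]`, and `κ` may be the endpoint `0`. A derivative
    -- within the interval is enough, since two-sided differentiability is already known from
    -- smoothness.
    have hmain := (uniqueDiffOn_Icc zero_lt_one (κ : ℝ) κ.2).eq_deriv _ hd1.hasDerivWithinAt
      (hd2.hasDerivWithinAt.congr heq (heq κ.2))
    have h3 := smul_right_injective E hτ0 hmain
    change HasDerivAt (fun t => Γ (x, t) 1) (f (Γ (x, κ * τ) 1)) (κ * τ)
    rw [hresc x τ hball κ, ← h3]
    exact hd
  · filter_upwards [Metric.ball_mem_nhds x₀ hε] with x hx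
    have hball : (x, (0 : ℝ)) ∈ Metric.ball (x₀, (0 : ℝ)) ε := by
      simpa [Prod.dist_eq, max_lt_iff, hε] using hx
    simpa using eq_of_integralDefect_eq_zero (hall _ hball).2.1 1

end Flow

/-- The standard basis of `E3`. -/
abbrev basisVec (i : Fin 3) : E3 := EuclideanSpace.single i 1

/-! ### The flow-box theorem. -/

section Straightening

lemma fderiv_apply_eq_of_hasDerivAt {E F : Type*} [NormedAddCommGroup E] [NormedSpace ℝ E]
    [NormedAddCommGroup F] [NormedSpace ℝ F] {f : E → F} {x v : E} {d : F}
    (hf : DifferentiableAt ℝ f x) (h : HasDerivAt (fun t : ℝ => f (x + t • v)) d 0) :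
    fderiv ℝ f x v = d := by
  rw [← hf.lineDeriv_eq_fderiv]
  exact HasLineDerivAt.lineDeriv h

/-- The flow-box theorem: a smooth vector field which does not vanish at `x₀` is the third
coordinate field of a smooth coordinate system around `x₀`. -/
theorem exists_straightening (u : E3 → E3) (hu : ContDiff ℝ ∞ u) (x₀ : E3) (h0 : u x₀ ≠ 0) :
    ∃ Ψ G : E3 → E3, ContDiff ℝ ∞ Ψ ∧ ContDiff ℝ ∞ G ∧ Ψ 0 = x₀ ∧ G x₀ = 0 ∧
      (∀ᶠ x in 𝓝 x₀, Ψ (G x) = x) ∧ (∀ᶠ y in 𝓝 0, G (Ψ y) = y) ∧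
      (∀ᶠ y in 𝓝 0, fderiv ℝ Ψ y (basisVec 2) = u (Ψ y)) ∧
      ∀ᶠ x in 𝓝 x₀, fderiv ℝ G x (u x) = basisVec 2 := by
  obtain ⟨φ', hφ', hflow', hinit'⟩ := exists_smooth_flow u hu x₀
  obtain ⟨φ, hφ, hφφ'⟩ := exists_contDiff_eventuallyEq hφ'
  have hflow : ∀ᶠ p in 𝓝 (x₀, (0 : ℝ)), HasDerivAt (fun t => φ (p.1, t)) (u (φ p)) p.2 := by
    filter_upwards [hflow', hφφ'.eventuallyEq_nhds] with p hp hpe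
    rw [hpe.self_of_nhds]
    refine hp.congr_of_eventuallyEq ?_
    have hc : ContinuousAt (fun t : ℝ => (p.1, t)) p.2 := by fun_prop
    exact hc.eventually hpe
  have hinit : ∀ᶠ x in 𝓝 x₀, φ (x, 0) = x := by
    have hc : ContinuousAt (fun x : E3 => (x, (0 : ℝ))) x₀ := by fun_prop
    filter_upwards [hinit', hc.eventually hφφ'] with x hx hx2
    rw [hx2, hx]
  have he2 : basisVec 2 ≠ 0 := by simp [basisVec]
  -- `A` sends the third basis vector to `u x₀`, so the image of the plane of the first two is
  -- transversal to `u`. `Ψ` flows from this plane for the time given by the third coordinate, and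
  -- its derivative at `0` is `A`.
  obtain ⟨A, hA⟩ := SeparatingDual.exists_continuousLinearEquiv_apply_eq (R := ℝ) he2 h0
  let T : E3 →L[ℝ] ℝ := EuclideanSpace.proj 2
  have hT2 : T (basisVec 2) = 1 := by simp [T, basisVec]
  let P : E3 → E3 × ℝ := fun y => (x₀ + A (y - T y • basisVec 2), T y)
  have hP : ContDiff ℝ ∞ P := by
    refine ContDiff.prodMk ?_ T.contDiff
    exact contDiff_const.add (A.contDiff.comp (contDiff_id.sub (T.contDiff.smul contDiff_const)))
  have hP0 : P 0 = (x₀, 0) := by simp [P]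
  let Ψ : E3 → E3 := fun y => φ (P y)
  have hΨ : ContDiff ℝ ∞ Ψ := hφ.comp hP
  have hΨ0 : Ψ 0 = x₀ := by
    change φ (P 0) = x₀
    rw [hP0, hinit.self_of_nhds]
  have hΨd : ∀ y, DifferentiableAt ℝ Ψ y := hΨ.differentiable (by simp)
  have hΨ2 : ∀ᶠ y in 𝓝 0, fderiv ℝ Ψ y (basisVec 2) = u (Ψ y) := by
    have hc : Filter.Tendsto P (𝓝 0) (𝓝 (x₀, 0)) := by
      rw [← hP0]; exact hP.continuous.continuousAt
    filter_upwards [hc.eventually hflow] with y hy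
    refine fderiv_apply_eq_of_hasDerivAt (hΨd y) ?_
    have h1 : (fun t : ℝ => Ψ (y + t • basisVec 2)) = fun t => φ ((P y).1, (P y).2 + t) := by
      funext t
      simp only [Ψ, P, map_add, map_smul, hT2, smul_eq_mul, mul_one]
      congr 4
      rw [add_smul]; abel
    rw [h1]
    have h2 : HasDerivAt (fun t => φ ((P y).1, t)) (u (φ (P y))) ((P y).2 + 0) := by
      rwa [add_zero]
    exact h2.comp_const_add (P y).2 0
  have hA' : HasFDerivAt Ψ (A : E3 →L[ℝ] E3) 0 := by
    have hd := (hΨd 0).hasFDerivAt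
    refine hd.congr_fderiv ?_
    ext1 h
    -- On vectors with vanishing third coordinate the flow time is zero, so `Ψ` is affine there.
    have hk : ∀ k : E3, T k = 0 → fderiv ℝ Ψ 0 k = A k := by
      intro k hk
      refine fderiv_apply_eq_of_hasDerivAt (hΨd 0) ?_
      have hc : ContinuousAt (fun t : ℝ => x₀ + t • A k) 0 := by fun_prop
      have hev : (fun t : ℝ => Ψ (0 + t • k)) =ᶠ[𝓝 0] fun t => x₀ + t • A k := by
        have h3 : Filter.Tendsto (fun t : ℝ => x₀ + t • A k) (𝓝 0) (𝓝 x₀) := by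
          simpa using hc.tendsto
        filter_upwards [h3.eventually hinit] with t ht
        simp only [Ψ, P, zero_add, map_smul, hk, smul_zero, zero_smul, sub_zero]
        exact ht
      refine HasDerivAt.congr_of_eventuallyEq ?_ hev
      simpa using ((hasDerivAt_id (0 : ℝ)).smul_const (A k)).const_add x₀
    have h4 : h = (h - T h • basisVec 2) + T h • basisVec 2 := by abel
    have h5 : T (h - T h • basisVec 2) = 0 := by simp [hT2]
    have h6 := hΨ2.self_of_nhds
    rw [hΨ0, ← hA] at h6
    rw [h4, map_add, hk _ h5, map_smul, h6]
    simp
  obtain ⟨G', hG'0, hG', hl, hr⟩ := exists_smooth_localInverse Ψ hΨ 0 A hA'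
  rw [hΨ0] at hG'0 hG' hr
  obtain ⟨G, hG, hGG'⟩ := exists_contDiff_eventuallyEq hG'
  have hG0 : G x₀ = 0 := by rw [hGG'.self_of_nhds, hG'0]
  have hcΨ : Filter.Tendsto Ψ (𝓝 0) (𝓝 x₀) := by
    conv_rhs => rw [← hΨ0]
    exact hΨ.continuous.continuousAt
  have hcG : Filter.Tendsto G (𝓝 x₀) (𝓝 0) := by
    conv_rhs => rw [← hG0]
    exact hG.continuous.continuousAt
  have hleft : ∀ᶠ y in 𝓝 0, G (Ψ y) = y := by
    filter_upwards [hl, hcΨ.eventually hGG'] with y h1 h2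
    rw [h2, h1]
  have hright : ∀ᶠ x in 𝓝 x₀, Ψ (G x) = x := by
    filter_upwards [hr, hGG'] with x h1 h2
    rw [h2, h1]
  refine ⟨Ψ, G, hΨ, hG, hΨ0, hG0, hright, hleft, hΨ2, ?_⟩
  filter_upwards [hright, hcG.eventually (eventually_eventually_nhds.2 hleft),
    hcG.eventually hΨ2] with x h1 h2 h3
  -- Differentiating `G ∘ Ψ = id` at `G x` turns the statement about `Ψ` into the one about `G`.
  have h4 : HasFDerivAt (fun y => G (Ψ y)) ((fderiv ℝ G x).comp (fderiv ℝ Ψ (G x))) (G x) := by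
    have := (hG.differentiable (by simp) (Ψ (G x))).hasFDerivAt.comp (G x) (hΨd (G x)).hasFDerivAt
    rwa [h1] at this
  have h5 := (h4.congr_of_eventuallyEq (Filter.EventuallyEq.symm h2)).unique (hasFDerivAt_id _)
  have h6 := congrArg (fun B : E3 →L[ℝ] E3 => B (basisVec 2)) h5
  simp only [ContinuousLinearMap.comp_apply, h3, h1] at h6
  simpa using h6

end Straightening

/-! ### Primitives along a coordinate and the transport equation. -/

section Primitive

open unitInterval

/-- A smooth primitive in one coordinate direction. -/
theorem exists_directional_primitive (F : E3 → ℝ) (hF : ContDiff ℝ ∞ F) (i : Fin 3) :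
    ∃ K : E3 → ℝ, ContDiff ℝ ∞ K ∧ (∀ y, fderiv ℝ K y (basisVec i) = F y) ∧
      ∀ j, j ≠ i → (∀ᶠ y in 𝓝 0, fderiv ℝ F y (basisVec j) = 0) →
        ∀ᶠ y in 𝓝 0, fderiv ℝ K y (basisVec j) = 0 := by
  -- The primitive is `K y = y i * ∫₀¹ F (y + y i (s - 1) eᵢ) ds`, the integral of `F` from the
  -- hyperplane `y i = 0` to `y`. The segment `c y` depends linearly on `y`, so smoothness of `K`
  -- follows from that of superposition.
  let η : C(I, E3) := ⟨fun s => ((s : ℝ) - 1) • basisVec i, by fun_prop⟩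
  let T : E3 →L[ℝ] ℝ := EuclideanSpace.proj i
  let c : E3 →L[ℝ] C(I, E3) := ContinuousLinearMap.const ℝ I + T.smulRight η
  have hc : ∀ y s, c y s = y + (y i * ((s : ℝ) - 1)) • basisVec i := by
    intro y s
    simp [c, T, η, smul_smul]
  let J : C(I, ℝ) →L[ℝ] ℝ := (ContinuousMap.evalCLM ℝ (1 : I)).comp (primitive ℝ)
  have hJ : ∀ (γ : C(I, ℝ)) (q : ℝ → ℝ), (∀ s : I, γ s = q s) → J γ = ∫ r in (0 : ℝ)..1, q r := by
    intro γ q h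
    refine intervalIntegral.integral_congr fun r hr => ?_
    rw [Set.Icc.coe_one, Set.uIcc_of_le zero_le_one] at hr
    change γ (Set.projIcc 0 1 zero_le_one r) = q r
    rw [Set.projIcc_of_mem _ hr, h]
  let K : E3 → ℝ := fun y => T y * J (superposition I F hF.continuous (c y))
  have hK : ContDiff ℝ ∞ K :=
    T.contDiff.mul (J.contDiff.comp ((contDiff_superposition F hF).comp c.contDiff))
  have hdK : ∀ y h, fderiv ℝ K y h = y i * J (pointwiseApply I E3 ℝ
      (superposition I (fderiv ℝ F) (hF.continuous_fderiv (by simp)) (c y)) (c h)) +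
      h i * J (superposition I F hF.continuous (c y)) := by
    intro y h
    have h1 := (J.hasFDerivAt.comp y ((hasFDerivAt_superposition F (hF.of_le (by simp))
      (c y)).comp y c.hasFDerivAt))
    have h2 := (T.hasFDerivAt (x := y)).mul h1
    have h3 : fderiv ℝ K y = _ := h2.fderiv
    rw [h3]
    simp [T, mul_comm]
  refine ⟨K, hK, fun y => ?_, fun j hj hFj => ?_⟩
  · rw [hdK]
    have hz : ∀ s : ℝ, HasDerivAt (fun s : ℝ => y + (y i * (s - 1)) • basisVec i)
        (y i • basisVec i) s := by
      intro s
      have := ((((hasDerivAt_id s).sub_const 1).const_mul (y i)).smul_const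
        (basisVec i)).const_add y
      simpa using this
    have hFz : ∀ s : ℝ, HasDerivAt (fun s : ℝ => F (y + (y i * (s - 1)) • basisVec i))
        (y i * fderiv ℝ F (y + (y i * (s - 1)) • basisVec i) (basisVec i)) s := by
      intro s
      have hFd := (hF.differentiable (by simp) (y + (y i * (s - 1)) • basisVec i)).hasFDerivAt
      rw [← smul_eq_mul, ← map_smul]
      exact hFd.comp_hasDerivAt s (hz s)
    have hcz : Continuous fun s : ℝ => y + (y i * (s - 1)) • basisVec i := by fun_prop
    have hcF : Continuous fun s : ℝ => F (y + (y i * (s - 1)) • basisVec i) :=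
      hF.continuous.comp hcz
    have hcF' : Continuous fun s : ℝ =>
        fderiv ℝ F (y + (y i * (s - 1)) • basisVec i) (basisVec i) :=
      ((hF.continuous_fderiv (by simp)).comp hcz).clm_apply continuous_const
    rw [hJ _ (fun s => s * fderiv ℝ F (y + (y i * (s - 1)) • basisVec i) (basisVec i)),
      hJ _ (fun s => F (y + (y i * (s - 1)) • basisVec i))]
    -- The integrand of `∂ᵢK` is the total derivative of `s F(z_s)` along the segment `z_s`, which
    -- ends at `y` for `s = 1`.
    · have h1 : ∀ s ∈ Set.uIcc (0 : ℝ) 1, HasDerivAt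
          (fun s : ℝ => s * F (y + (y i * (s - 1)) • basisVec i))
          (F (y + (y i * (s - 1)) • basisVec i) + y i * (s *
            fderiv ℝ F (y + (y i * (s - 1)) • basisVec i) (basisVec i))) s := by
        intro s _
        convert! (hasDerivAt_id s).mul (hFz s) using 1
        simp only [id]; ring
      have h2 := intervalIntegral.integral_eq_sub_of_hasDerivAt h1
        (Continuous.intervalIntegrable (by fun_prop) _ _)
      rw [intervalIntegral.integral_add (hcF.intervalIntegrable _ _)
        (Continuous.intervalIntegrable (by fun_prop) _ _),
        intervalIntegral.integral_const_mul] at h2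
      simp at h2
      simp [← h2, add_comm]
    · intro s
      change F (c y s) = _
      rw [hc]
    · intro s
      change fderiv ℝ F (c y s) (c (basisVec i) s) = _
      rw [hc, hc]
      have : basisVec i + (basisVec i i * ((s : ℝ) - 1)) • basisVec i = (s : ℝ) • basisVec i := by
        have h1 : basisVec i i = 1 := by simp [basisVec]
        rw [h1, one_mul, sub_smul, one_smul]; abel
      rw [this, map_smul, smul_eq_mul]
  · obtain ⟨ρ, hρ, hb⟩ := Metric.eventually_nhds_iff_ball.1 hFj
    -- For `y` near `0` the whole segment lies in the ball where `∂ⱼF = 0`. Varying `y` along `eⱼ`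
    -- translates the segment by `eⱼ`, so the derivative integrates `∂ⱼF`.
    have hcc : ∀ᶠ y in 𝓝 (0 : E3), c y ∈ Metric.ball (0 : C(I, E3)) ρ := by
      have := c.continuous.continuousAt (x := 0)
      rw [ContinuousAt, map_zero] at this
      exact this.eventually (Metric.ball_mem_nhds _ hρ)
    have hji : basisVec j i = 0 := by simp [basisVec, hj.symm]
    filter_upwards [hcc] with y hy
    rw [hdK, hji, zero_mul, add_zero, hJ _ fun _ => 0]
    · simp
    · intro s
      change fderiv ℝ F (c y s) (c (basisVec j) s) = _
      rw [hc (basisVec j), hji, zero_mul, zero_smul, add_zero]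
      refine hb _ ?_
      rw [mem_ball_zero_iff] at hy ⊢
      exact ((c y).norm_coe_le_norm s).trans_lt hy

/-- Local solvability of the transport equation `w · ∇β = f` where `w` does not vanish. -/
theorem exists_transport_solution (w : E3 → E3) (hw : ContDiff ℝ ∞ w) (x₀ : E3) (h0 : w x₀ ≠ 0)
    (f : E3 → ℝ) (hf : ContDiff ℝ ∞ f) :
    ∃ β : E3 → ℝ, ContDiff ℝ ∞ β ∧ ∀ᶠ x in 𝓝 x₀, fderiv ℝ β x (w x) = f x := by
  obtain ⟨Ψ, G, hΨ, hG, -, -, hr, -, -, hGw⟩ := exists_straightening w hw x₀ h0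
  obtain ⟨K, hK, hKF, -⟩ := exists_directional_primitive (fun y => f (Ψ y)) (hf.comp hΨ) 2
  refine ⟨fun x => K (G x), hK.comp hG, ?_⟩
  filter_upwards [hr, hGw] with x h1 h2
  have := fderiv_comp x (hK.differentiable (by simp) (G x)) (hG.differentiable (by simp) x)
  change fderiv ℝ (K ∘ G) x (w x) = _
  rw [this, ContinuousLinearMap.comp_apply, h2, hKF, h1]

end Primitive

/-! ### Vector calculus identities, commuting fields and potentials. -/

section VectorCalculus

@[simp] lemma cross_zero_apply (a b : E3) : cross a b 0 = a 1 * b 2 - a 2 * b 1 := rfl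
@[simp] lemma cross_one_apply (a b : E3) : cross a b 1 = a 2 * b 0 - a 0 * b 2 := rfl
@[simp] lemma cross_two_apply (a b : E3) : cross a b 2 = a 0 * b 1 - a 1 * b 0 := rfl
@[simp] lemma curl_zero_apply (v : E3 → E3) (x : E3) :
    curl v x 0 = partialD 1 2 v x - partialD 2 1 v x := rfl
@[simp] lemma curl_one_apply (v : E3 → E3) (x : E3) :
    curl v x 1 = partialD 2 0 v x - partialD 0 2 v x := rfl
@[simp] lemma curl_two_apply (v : E3 → E3) (x : E3) :
    curl v x 2 = partialD 0 1 v x - partialD 1 0 v x := rfl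

lemma div_congr {a b : E3 → E3} {x : E3} (h : a =ᶠ[𝓝 x] b) : div a x = div b x := by
  simp only [div, partialD, h.fderiv_eq]

lemma curl_congr {a b : E3 → E3} {x : E3} (h : a =ᶠ[𝓝 x] b) : curl a x = curl b x := by
  simp only [curl, partialD, h.fderiv_eq]

lemma ext_E3 {a b : E3} (h0 : a 0 = b 0) (h1 : a 1 = b 1) (h2 : a 2 = b 2) : a = b := by
  ext i; fin_cases i <;> assumption

lemma inner_E3 (a b : E3) : inner ℝ a b = a 0 * b 0 + a 1 * b 1 + a 2 * b 2 := by
  simp [PiLp.inner_apply, Fin.sum_univ_three, mul_comm]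

lemma eq_sum_basisVec (h : E3) :
    h = h 0 • basisVec 0 + h 1 • basisVec 1 + h 2 • basisVec 2 := by
  apply ext_E3 <;> simp [basisVec]

lemma fderiv_coord {v : E3 → E3} {x : E3} (hv : DifferentiableAt ℝ v x) (j : Fin 3) (h : E3) :
    fderiv ℝ (fun y => v y j) x h = fderiv ℝ v x h j := by
  have := ((EuclideanSpace.proj j : E3 →L[ℝ] ℝ).hasFDerivAt.comp x hv.hasFDerivAt).fderiv
  change fderiv ℝ ((EuclideanSpace.proj j : E3 →L[ℝ] ℝ) ∘ v) x h = _
  rw [this]; rfl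

lemma gradient_coord (f : E3 → ℝ) (x : E3) (i : Fin 3) :
    gradient f x i = fderiv ℝ f x (basisVec i) := by
  rw [← inner_gradient_left, basisVec, EuclideanSpace.inner_single_right]
  simp

lemma inner_gradient (f : E3 → ℝ) (x h : E3) : inner ℝ (gradient f x) h = fderiv ℝ f x h :=
  inner_gradient_left

lemma contDiff_E3 {n : WithTop ℕ∞} {E : Type*} [NormedAddCommGroup E] [NormedSpace ℝ E]
    {v : E → E3} (h0 : ContDiff ℝ n fun x => v x 0)
    (h1 : ContDiff ℝ n fun x => v x 1) (h2 : ContDiff ℝ n fun x => v x 2) : ContDiff ℝ n v := by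
  rw [contDiff_euclidean]
  intro i; fin_cases i <;> assumption

lemma contDiff_fderiv_apply {E F : Type*} [NormedAddCommGroup E] [NormedSpace ℝ E]
    [NormedAddCommGroup F] [NormedSpace ℝ F] {f : E → F} (hf : ContDiff ℝ ∞ f) (h : E) :
    ContDiff ℝ ∞ fun x => fderiv ℝ f x h :=
  (contDiff_infty_iff_fderiv.1 hf).2.clm_apply contDiff_const

lemma contDiff_coord {E : Type*} [NormedAddCommGroup E] [NormedSpace ℝ E]
    {v : E → E3} (hv : ContDiff ℝ ∞ v) (i : Fin 3) : ContDiff ℝ ∞ fun x => v x i :=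
  contDiff_euclidean.1 hv i

lemma contDiff_gradient {f : E3 → ℝ} (hf : ContDiff ℝ ∞ f) : ContDiff ℝ ∞ (gradient f) := by
  apply contDiff_E3 <;> simp only [gradient_coord] <;> exact contDiff_fderiv_apply hf _

lemma contDiff_partialD {v : E3 → E3} (hv : ContDiff ℝ ∞ v) (i j : Fin 3) :
    ContDiff ℝ ∞ (partialD i j v) :=
  contDiff_coord (contDiff_fderiv_apply hv _) j

lemma contDiff_curl {v : E3 → E3} (hv : ContDiff ℝ ∞ v) : ContDiff ℝ ∞ (curl v) := by
  apply contDiff_E3 <;> exact (contDiff_partialD hv _ _).sub (contDiff_partialD hv _ _)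

lemma contDiff_div {v : E3 → E3} (hv : ContDiff ℝ ∞ v) : ContDiff ℝ ∞ (div v) :=
  ContDiff.sum fun _ _ => contDiff_partialD hv _ _

lemma contDiff_cross {a b : E3 → E3} (ha : ContDiff ℝ ∞ a) (hb : ContDiff ℝ ∞ b) :
    ContDiff ℝ ∞ fun x => cross (a x) (b x) := by
  have ha' := contDiff_coord ha
  have hb' := contDiff_coord hb
  apply contDiff_E3 <;> exact ((ha' _).mul (hb' _)).sub ((ha' _).mul (hb' _))

lemma differentiableAt_cross {a b : E3 → E3} {x : E3} (ha : DifferentiableAt ℝ a x)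
    (hb : DifferentiableAt ℝ b x) : DifferentiableAt ℝ (fun y => cross (a y) (b y)) x := by
  have ha' := differentiableAt_euclidean.1 ha
  have hb' := differentiableAt_euclidean.1 hb
  rw [differentiableAt_euclidean]
  intro i
  fin_cases i <;> exact ((ha' _).mul (hb' _)).sub ((ha' _).mul (hb' _))

lemma fderiv_cross {a b : E3 → E3} {x : E3} (ha : DifferentiableAt ℝ a x)
    (hb : DifferentiableAt ℝ b x) (h : E3) :
    fderiv ℝ (fun y => cross (a y) (b y)) x h
      = cross (fderiv ℝ a x h) (b x) + cross (a x) (fderiv ℝ b x h) := by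
  have ha' := differentiableAt_euclidean.1 ha
  have hb' := differentiableAt_euclidean.1 hb
  have key : ∀ p q r s : Fin 3, fderiv ℝ (fun y => a y p * b y q - a y r * b y s) x h
      = (fderiv ℝ a x h p * b x q + a x p * fderiv ℝ b x h q)
        - (fderiv ℝ a x h r * b x s + a x r * fderiv ℝ b x h s) := by
    intro p q r s
    have h1 := (((ha' p).hasFDerivAt.mul (hb' q).hasFDerivAt).sub
      ((ha' r).hasFDerivAt.mul (hb' s).hasFDerivAt)).fderiv
    have h2 := congrArg (fun B : E3 →L[ℝ] ℝ => B h) h1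
    refine h2.trans ?_
    simp only [_root_.sub_apply, _root_.add_apply, _root_.smul_apply, smul_eq_mul,
      fderiv_coord ha, fderiv_coord hb]
    ring
  have hc := differentiableAt_cross ha hb
  apply ext_E3 <;> rw [← fderiv_coord hc] <;> refine (key _ _ _ _).trans ?_ <;>
    simp only [PiLp.add_apply, cross_zero_apply, cross_one_apply, cross_two_apply] <;> ring

lemma partialD_smul {f : E3 → ℝ} {v : E3 → E3} {x : E3} (hf : DifferentiableAt ℝ f x)
    (hv : DifferentiableAt ℝ v x) (i j : Fin 3) :
    partialD i j (fun y => f y • v y) x = f x * partialD i j v x + gradient f x i * v x j := by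
  simp [partialD, fderiv_fun_smul hf hv, gradient_coord]

lemma partialD_add {a b : E3 → E3} {x : E3} (ha : DifferentiableAt ℝ a x)
    (hb : DifferentiableAt ℝ b x) (i j : Fin 3) :
    partialD i j (fun y => a y + b y) x = partialD i j a x + partialD i j b x := by
  simp [partialD, fderiv_fun_add ha hb]

lemma partialD_gradient {f : E3 → ℝ} (hf : ContDiff ℝ ∞ f) (x : E3) (i j : Fin 3) :
    partialD i j (gradient f) x = fderiv ℝ (fderiv ℝ f) x (basisVec i) (basisVec j) := by
  have h1 : ContDiff ℝ ∞ (fderiv ℝ f) := (contDiff_infty_iff_fderiv.1 hf).2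
  rw [partialD, ← fderiv_coord ((contDiff_gradient hf).differentiable (by simp) x)]
  simp only [gradient_coord]
  rw [fderiv_clm_apply (h1.differentiable (by simp) x) (by fun_prop)]
  simp

lemma partialD_gradient_symm {f : E3 → ℝ} (hf : ContDiff ℝ ∞ f) (x : E3) (i j : Fin 3) :
    partialD i j (gradient f) x = partialD j i (gradient f) x := by
  rw [partialD_gradient hf, partialD_gradient hf]
  exact (hf.contDiffAt.isSymmSndFDerivAt
    (by simpa using WithTop.coe_le_coe.2 (le_top : (2 : ℕ∞) ≤ ⊤))).eq _ _

lemma curl_gradient {f : E3 → ℝ} (hf : ContDiff ℝ ∞ f) (x : E3) : curl (gradient f) x = 0 := by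
  apply ext_E3
  · simp [partialD_gradient_symm hf x 1 2]
  · simp [partialD_gradient_symm hf x 2 0]
  · simp [partialD_gradient_symm hf x 0 1]

lemma curl_add {a b : E3 → E3} {x : E3} (ha : DifferentiableAt ℝ a x)
    (hb : DifferentiableAt ℝ b x) : curl (fun y => a y + b y) x = curl a x + curl b x := by
  apply ext_E3 <;> simp [partialD_add ha hb] <;> ring

lemma curl_smul {f : E3 → ℝ} {v : E3 → E3} {x : E3} (hf : DifferentiableAt ℝ f x)
    (hv : DifferentiableAt ℝ v x) :
    curl (fun y => f y • v y) x = f x • curl v x + cross (gradient f x) (v x) := by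
  apply ext_E3 <;> simp [partialD_smul hf hv] <;> ring

lemma curl_smul_gradient {f g : E3 → ℝ} {x : E3} (hf : DifferentiableAt ℝ f x)
    (hg : ContDiff ℝ ∞ g) :
    curl (fun y => f y • gradient g y) x = cross (gradient f x) (gradient g x) := by
  rw [curl_smul hf ((contDiff_gradient hg).differentiable (by simp) x), curl_gradient hg,
    smul_zero, zero_add]

lemma div_add {a b : E3 → E3} {x : E3} (ha : DifferentiableAt ℝ a x)
    (hb : DifferentiableAt ℝ b x) : div (fun y => a y + b y) x = div a x + div b x := by
  simp [div, partialD_add ha hb, Finset.sum_add_distrib]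

lemma div_smul {f : E3 → ℝ} {v : E3 → E3} {x : E3} (hf : DifferentiableAt ℝ f x)
    (hv : DifferentiableAt ℝ v x) :
    div (fun y => f y • v y) x = f x * div v x + fderiv ℝ f x (v x) := by
  rw [← inner_gradient, inner_E3]
  simp only [div, Fin.sum_univ_three, partialD_smul hf hv]
  ring

lemma partialD_partialD_symm {v : E3 → E3} (hv : ContDiff ℝ ∞ v) (x : E3) (i j k : Fin 3) :
    fderiv ℝ (partialD i k v) x (basisVec j) = fderiv ℝ (partialD j k v) x (basisVec i) := by
  have hk := contDiff_coord hv k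
  have h : ∀ l, partialD l k v = fun y => gradient (fun y => v y k) y l := by
    intro l; funext y
    rw [gradient_coord, fderiv_coord (hv.differentiable (by simp) y)]; rfl
  have hd := (contDiff_gradient hk).differentiable (by simp) x
  rw [h, h, fderiv_coord hd, fderiv_coord hd]
  exact partialD_gradient_symm hk x j i

lemma div_curl {v : E3 → E3} (hv : ContDiff ℝ ∞ v) (x : E3) : div (curl v) x = 0 := by
  have hd := (contDiff_curl hv).differentiable (by simp) x
  have hp : ∀ i j, DifferentiableAt ℝ (partialD i j v) x := fun i j =>
    (contDiff_partialD hv i j).differentiable (by simp) x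
  have key : ∀ p q r s : Fin 3, ∀ h, fderiv ℝ (fun y => partialD p q v y - partialD r s v y) x h
      = fderiv ℝ (partialD p q v) x h - fderiv ℝ (partialD r s v) x h := by
    intro p q r s h
    rw [fderiv_fun_sub (hp _ _) (hp _ _)]; rfl
  have h := partialD_partialD_symm hv x
  have hc : ∀ i j, partialD i j (curl v) x = fderiv ℝ (fun y => curl v y j) x (basisVec i) :=
    fun i j => (fderiv_coord hd j _).symm
  simp only [div, Fin.sum_univ_three, hc, curl_zero_apply, curl_one_apply, curl_two_apply]
  rw [key, key, key, h 1 0 2, h 2 0 1, h 2 1 0]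
  ring

lemma div_cross_gradient {f g : E3 → ℝ} (hf : ContDiff ℝ ∞ f) (hg : ContDiff ℝ ∞ g) (x : E3) :
    div (fun y => cross (gradient f y) (gradient g y)) x = 0 := by
  have h : (fun y => cross (gradient f y) (gradient g y)) = curl fun y => f y • gradient g y := by
    funext y
    exact (curl_smul_gradient (hf.differentiable (by simp) y) hg).symm
  rw [h]
  exact div_curl (hf.smul (contDiff_gradient hg)) x

lemma fderiv_coord_eq_sum (v : E3 → E3) (x h : E3) (j : Fin 3) : fderiv ℝ v x h j
    = h 0 * partialD 0 j v x + h 1 * partialD 1 j v x + h 2 * partialD 2 j v x := by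
  conv_lhs => rw [eq_sum_basisVec h]
  simp [partialD]

/-- `curl (a × b) = [b, a] + (div b) a - (div a) b`. -/
lemma curl_cross {a b : E3 → E3} {x : E3} (ha : DifferentiableAt ℝ a x)
    (hb : DifferentiableAt ℝ b x) : curl (fun y => cross (a y) (b y)) x
      = VectorField.lieBracket ℝ b a x + div b x • a x - div a x • b x := by
  have h : ∀ i j, partialD i j (fun y => cross (a y) (b y)) x
      = cross (fderiv ℝ a x (basisVec i)) (b x) j + cross (a x) (fderiv ℝ b x (basisVec i)) j := by
    intro i j
    rw [partialD, fderiv_cross ha hb]; rfl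
  have hpa : ∀ i j, fderiv ℝ a x (basisVec i) j = partialD i j a x := fun _ _ => rfl
  have hpb : ∀ i j, fderiv ℝ b x (basisVec i) j = partialD i j b x := fun _ _ => rfl
  apply ext_E3 <;>
    simp only [curl_zero_apply, curl_one_apply, curl_two_apply, h, cross_zero_apply,
      cross_one_apply, cross_two_apply, hpa, hpb, VectorField.lieBracket_eq, PiLp.add_apply,
      PiLp.sub_apply, PiLp.smul_apply, smul_eq_mul, fderiv_coord_eq_sum a, fderiv_coord_eq_sum b,
      div, Fin.sum_univ_three] <;> ring

/-- Solenoidal fields whose cross product is a gradient commute. -/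
lemma lieBracket_eq_zero_of_cross_eq_gradient {a b : E3 → E3} {g : E3 → ℝ} {x : E3}
    (ha : DifferentiableAt ℝ a x) (hb : DifferentiableAt ℝ b x) (hg : ContDiff ℝ ∞ g)
    (hda : div a x = 0) (hdb : div b x = 0)
    (h : (fun y => cross (a y) (b y)) =ᶠ[𝓝 x] gradient g) :
    VectorField.lieBracket ℝ b a x = 0 := by
  have h1 := curl_cross ha hb
  rw [curl_congr h, curl_gradient hg, hda, hdb] at h1
  simpa using h1.symm

/-- The identification of `E3` with its dual. -/
def dualMap : E3 →L[ℝ] E3 →L[ℝ] ℝ := LinearMap.toContinuousLinearMap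
  { toFun := fun x => InnerProductSpace.toDual ℝ E3 x
    map_add' := fun x y => map_add _ x y
    map_smul' := fun c x => by simp }

lemma gradient_eq_of_dualMap {z : E3 → ℝ} {x v : E3} (h : HasFDerivAt z (dualMap v) x) :
    gradient z x = v := by
  rw [gradient, h.fderiv]
  exact (InnerProductSpace.toDual ℝ E3).symm_apply_apply v

/-- A function with smooth gradient near a point agrees there with a globally smooth function. -/
lemma exists_contDiff_of_gradient {v : E3 → E3} (hv : ContDiff ℝ ∞ v) {x₀ : E3} {z : E3 → ℝ}
    (h : ∀ᶠ x in 𝓝 x₀, HasFDerivAt z (dualMap (v x)) x) :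
    ∃ z' : E3 → ℝ, ContDiff ℝ ∞ z' ∧ z' =ᶠ[𝓝 x₀] z := by
  obtain ⟨r, hr, hz⟩ := Metric.eventually_nhds_iff_ball.1 h
  refine exists_contDiff_eventuallyEq ?_
  filter_upwards [Metric.ball_mem_nhds x₀ hr] with x hx
  have : ContDiffOn ℝ ∞ z (Metric.ball x₀ r) := by
    rw [contDiffOn_infty_iff_fderiv_of_isOpen Metric.isOpen_ball]
    refine ⟨fun y hy => (hz y hy).differentiableAt.differentiableWithinAt, ?_⟩
    exact (dualMap.contDiff.comp hv).contDiffOn.congr fun y hy => (hz y hy).fderiv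
  exact this.contDiffAt (Metric.isOpen_ball.mem_nhds hx)

/-- A curl-free field is locally a gradient. -/
lemma exists_potential {v : E3 → E3} (hv : ContDiff ℝ ∞ v) {x₀ : E3}
    (h : ∀ᶠ x in 𝓝 x₀, curl v x = 0) :
    ∃ z : E3 → ℝ, ContDiff ℝ ∞ z ∧ ∀ᶠ x in 𝓝 x₀, gradient z x = v x := by
  obtain ⟨r, hr, hb⟩ := Metric.eventually_nhds_iff_ball.1 h
  have hDd : ∀ a x y, fderiv ℝ (fun y => dualMap (v y)) a x y = inner ℝ (fderiv ℝ v a x) y := by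
    intro a x y
    have h1 : fderiv ℝ (fun y => dualMap (v y)) a = _ :=
      (dualMap.hasFDerivAt.comp a (hv.differentiable (by simp) a).hasFDerivAt).fderiv
    rw [h1]
    rfl
  obtain ⟨z, hz⟩ : ∃ z : E3 → ℝ, ∀ a ∈ Metric.ball x₀ r, HasFDerivAt z (dualMap (v a)) a :=
    (convex_ball x₀ r).exists_forall_hasFDerivAt_of_fderiv_symmetric Metric.isOpen_ball
      ((dualMap.contDiff.comp hv).differentiable (by simp)).differentiableOn (by
      -- Vanishing curl is exactly symmetry of the Jacobian matrix, the integrability condition on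
      -- the convex ball.
      intro a ha x y
      have h0 := hb a ha
      have e0 : partialD 1 2 v a = partialD 2 1 v a :=
        sub_eq_zero.1 (congrArg (fun c : E3 => c 0) h0)
      have e1 : partialD 2 0 v a = partialD 0 2 v a :=
        sub_eq_zero.1 (congrArg (fun c : E3 => c 1) h0)
      have e2 : partialD 0 1 v a = partialD 1 0 v a :=
        sub_eq_zero.1 (congrArg (fun c : E3 => c 2) h0)
      change fderiv ℝ (fun y => dualMap (v y)) a x y = fderiv ℝ (fun y => dualMap (v y)) a y x
      rw [hDd, hDd, inner_E3, inner_E3]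
      simp only [fderiv_coord_eq_sum v, e0, e1, e2]
      ring)
  have hball := Metric.ball_mem_nhds x₀ hr
  obtain ⟨z', hz', hzz'⟩ := exists_contDiff_of_gradient hv (Filter.mem_of_superset hball hz)
  refine ⟨z', hz', ?_⟩
  filter_upwards [hzz'.gradient, hball] with x h1 h2
  rw [h1, gradient_eq_of_dualMap (hz x h2)]

end VectorCalculus

/-! ### Algebra of the cross product. -/

section CrossAlgebra

lemma inner_self_ne_zero_E3 {a : E3} (ha : a ≠ 0) : inner ℝ a a ≠ 0 := by
  simpa using ha

/-- This is a × (a × b) = (a · b) a - |a|² b with the left side zero. The explicit coefficient is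
what later gives ĥ and the smoothness of the density of curl w. -/
lemma eq_smul_of_cross_eq_zero {a b : E3} (ha : a ≠ 0) (h : cross a b = 0) :
    b = (inner ℝ a b / inner ℝ a a) • a := by
  have hn := inner_self_ne_zero_E3 ha
  have h0 : a 1 * b 2 - a 2 * b 1 = 0 := congrArg (fun c : E3 => c 0) h
  have h1 : a 2 * b 0 - a 0 * b 2 = 0 := congrArg (fun c : E3 => c 1) h
  have h2 : a 0 * b 1 - a 1 * b 0 = 0 := congrArg (fun c : E3 => c 2) h
  have key : inner ℝ a a • b = inner ℝ a b • a := by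
    apply ext_E3 <;> simp only [inner_E3, PiLp.smul_apply, smul_eq_mul]
    · linear_combination a 2 * h1 - a 1 * h2
    · linear_combination a 0 * h2 - a 2 * h0
    · linear_combination a 1 * h0 - a 0 * h1
  rw [div_eq_inv_mul, mul_smul, ← key, smul_smul, inv_mul_cancel₀ hn, one_smul]

lemma cross_add_left (a b c : E3) : cross (a + b) c = cross a c + cross b c := by
  apply ext_E3 <;> simp <;> ring

lemma cross_add_right (a b c : E3) : cross a (b + c) = cross a b + cross a c := by
  apply ext_E3 <;> simp <;> ring

lemma cross_smul_left (r : ℝ) (a b : E3) : cross (r • a) b = r • cross a b := by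
  apply ext_E3 <;> simp <;> ring

lemma cross_smul_right (r : ℝ) (a b : E3) : cross a (r • b) = r • cross a b := by
  apply ext_E3 <;> simp <;> ring

lemma cross_self (a : E3) : cross a a = 0 := by
  apply ext_E3 <;> simp <;> ring

lemma cross_swap (a b : E3) : cross a b = -cross b a := by
  apply ext_E3 <;> simp <;> ring

/-- By (a × b) × u = (a · u) b - (b · u) a. -/
lemma cross_cross_eq_zero {a b u : E3} (ha : inner ℝ a u = 0) (hb : inner ℝ b u = 0) :
    cross (cross a b) u = 0 := by
  rw [inner_E3] at ha hb
  apply ext_E3 <;> simp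
  · linear_combination b 0 * ha - a 0 * hb
  · linear_combination b 1 * ha - a 1 * hb
  · linear_combination b 2 * ha - a 2 * hb

lemma inner_cross_cross (a b p q : E3) : inner ℝ (cross a b) (cross p q)
    = inner ℝ a p * inner ℝ b q - inner ℝ a q * inner ℝ b p := by
  simp only [inner_E3, cross_zero_apply, cross_one_apply, cross_two_apply]
  ring

end CrossAlgebra

/-! ### Darboux normal form and Beltrami coordinates. -/

section Darboux

/-- Local Clebsch-type normal form `w = ∇z - L ∇θ` of a smooth field with `curl w ≠ 0`. -/
theorem exists_darboux_form (w : E3 → E3) (hw : ContDiff ℝ ∞ w) (x₀ : E3)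
    (h0 : curl w x₀ ≠ 0) :
    ∃ z L θ : E3 → ℝ, ContDiff ℝ ∞ z ∧ ContDiff ℝ ∞ L ∧ ContDiff ℝ ∞ θ ∧ θ x₀ = 0 ∧
      ∀ᶠ x in 𝓝 x₀, w x = gradient z x - L x • gradient θ x := by
  have hu := contDiff_curl hw
  obtain ⟨Ψ, G, hΨ, hG, hΨ0, hG0, hr, hl, hΨ2, hGu⟩ := exists_straightening (curl w) hu x₀ h0
  have hGd : ∀ x, DifferentiableAt ℝ G x := hG.differentiable (by simp)
  have hΨd : ∀ x, DifferentiableAt ℝ Ψ x := hΨ.differentiable (by simp)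
  have hGi := contDiff_coord hG
  have hgrad : ∀ i x h, inner ℝ (gradient (fun y => G y i) x) h = fderiv ℝ G x h i :=
    fun i x h => by rw [inner_gradient, fderiv_coord (hGd x)]
  set c : E3 → E3 := fun x => cross (gradient (fun y => G y 0) x) (gradient (fun y => G y 1) x)
    with hc
  have hcs : ContDiff ℝ ∞ c := contDiff_cross (contDiff_gradient (hGi 0))
    (contDiff_gradient (hGi 1))
  have hc0 : c x₀ ≠ 0 := by
    have h1 : HasFDerivAt (fun y => G (Ψ y)) ((fderiv ℝ G x₀).comp (fderiv ℝ Ψ 0)) 0 := by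
      have := (hGd (Ψ 0)).hasFDerivAt.comp 0 (hΨd 0).hasFDerivAt
      rwa [hΨ0] at this
    have h2 := (h1.congr_of_eventuallyEq (Filter.EventuallyEq.symm hl)).unique (hasFDerivAt_id _)
    have h3 : ∀ v, fderiv ℝ G x₀ (fderiv ℝ Ψ 0 v) = v := fun v =>
      congrArg (fun B : E3 →L[ℝ] E3 => B v) h2
    intro hc0
    -- The product is the determinant of the pairings of ∇G₀, ∇G₁ with the first two columns of
    -- `DΨ`, an identity matrix because `G` inverts `Ψ`.
    have h4 : inner ℝ (c x₀) (cross (fderiv ℝ Ψ 0 (basisVec 0)) (fderiv ℝ Ψ 0 (basisVec 1)))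
        = 1 := by
      rw [hc, inner_cross_cross]
      simp only [hgrad, h3]
      simp [basisVec]
    rw [hc0, inner_zero_left] at h4
    exact zero_ne_one h4
  have hcne : ∀ᶠ x in 𝓝 x₀, c x ≠ 0 := hcs.continuous.continuousAt.eventually_ne hc0
  have hfs : ∀ᶠ x in 𝓝 x₀, ContDiffAt ℝ ∞
      (fun x => inner ℝ (c x) (curl w x) / inner ℝ (c x) (c x)) x := by
    filter_upwards [hcne] with x hx
    exact ((hcs.inner ℝ hu).contDiffAt).div (hcs.inner ℝ hcs).contDiffAt
      (inner_self_ne_zero_E3 hx)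
  obtain ⟨f, hf, hff⟩ := exists_contDiff_eventuallyEq hfs
  have huc : ∀ᶠ x in 𝓝 x₀, curl w x = f x • c x := by
    filter_upwards [hGu, hcne, hff] with x h1 h2 h3
    rw [h3]
    refine eq_smul_of_cross_eq_zero h2 (cross_cross_eq_zero ?_ ?_)
    · rw [hgrad, h1]; simp [basisVec]
    · rw [hgrad, h1]; simp [basisVec]
  -- Both curl w = f c and c are solenoidal, so `f` is constant along curl w.
  have hfu : ∀ᶠ x in 𝓝 x₀, fderiv ℝ f x (curl w x) = 0 := by
    filter_upwards [huc, huc.eventually_nhds] with x h1 h2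
    have h3 : div (curl w) x = div (fun y => f y • c y) x := div_congr h2
    rw [div_curl hw, div_smul (hf.differentiable (by simp) x) (hcs.differentiable (by simp) x),
      div_cross_gradient (hGi 0) (hGi 1), mul_zero, zero_add] at h3
    rw [h1, map_smul, ← h3, smul_zero]
  have hcΨ : Filter.Tendsto Ψ (𝓝 0) (𝓝 x₀) := by
    conv_rhs => rw [← hΨ0]
    exact hΨ.continuous.continuousAt
  have hcG : Filter.Tendsto G (𝓝 x₀) (𝓝 0) := by
    conv_rhs => rw [← hG0]
    exact hG.continuous.continuousAt
  -- In straightened coordinates `f` does not depend on the third variable, so its primitive in the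
  -- second can be taken independent of the third as well.
  obtain ⟨K, hK, hK1, hK2⟩ := exists_directional_primitive (fun y => f (Ψ y)) (hf.comp hΨ) 1
  have hK2 : ∀ᶠ y in 𝓝 0, fderiv ℝ K y (basisVec 2) = 0 := by
    refine hK2 2 (by decide) ?_
    filter_upwards [hΨ2, hcΨ.eventually hfu] with y h1 h2
    have h3 := fderiv_comp y (hf.differentiable (by simp) (Ψ y)) (hΨd y)
    change fderiv ℝ (f ∘ Ψ) y _ = 0
    rw [h3, ContinuousLinearMap.comp_apply, h1, h2]
  have hL : ContDiff ℝ ∞ fun x => K (G x) := hK.comp hG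
  have hgL : ∀ᶠ x in 𝓝 x₀, gradient (fun x => K (G x)) x
      = fderiv ℝ K (G x) (basisVec 0) • gradient (fun y => G y 0) x
        + f x • gradient (fun y => G y 1) x := by
    filter_upwards [hcG.eventually hK2, hr] with x h1 h2
    refine ext_inner_right ℝ fun h => ?_
    rw [inner_gradient, inner_add_left, inner_smul_left, inner_smul_left, hgrad, hgrad]
    have h3 := fderiv_comp x (hK.differentiable (by simp) (G x)) (hGd x)
    change fderiv ℝ (K ∘ G) x h = _
    rw [h3, ContinuousLinearMap.comp_apply]
    conv_lhs => rw [eq_sum_basisVec (fderiv ℝ G x h)]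
    simp only [map_add, map_smul, h1, hK1, h2]
    simp [mul_comm]
  have hLd : ∀ x, DifferentiableAt ℝ (fun x => K (G x)) x := hL.differentiable (by simp)
  have hv : ContDiff ℝ ∞ fun x => w x + K (G x) • gradient (fun y => G y 0) x :=
    hw.add (hL.smul (contDiff_gradient (hGi 0)))
  -- With L = K ∘ G and θ = G₀, ∇L × ∇θ = f ∇G₁ × ∇G₀ = -curl w, so w + L ∇θ is curl-free.
  obtain ⟨z, hz, hzv⟩ := exists_potential (x₀ := x₀) hv (by
    filter_upwards [hgL, huc] with x h1 h2
    have h3 : ContDiff ℝ ∞ fun x => K (G x) • gradient (fun y => G y 0) x :=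
      hL.smul (contDiff_gradient (hGi 0))
    rw [curl_add (hw.differentiable (by simp) x) (h3.differentiable (by simp) x),
      curl_smul_gradient (hLd x) (hGi 0), h1, cross_add_left, cross_smul_left, cross_smul_left,
      cross_self, h2, cross_swap (gradient (fun y => G y 1) x)]
    simp [hc])
  refine ⟨z, fun x => K (G x), fun x => G x 0, hz, hL, hGi 0, by simp [hG0], ?_⟩
  filter_upwards [hzv] with x hx
  rw [hx, add_sub_cancel_right]

lemma gradient_eq_of_hasFDerivAt {f : E3 → ℝ} {f' : E3 →L[ℝ] ℝ} {x v : E3}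
    (hf : HasFDerivAt f f' x) (h : ∀ k, f' k = inner ℝ v k) : gradient f x = v := by
  refine ext_inner_right ℝ fun k => ?_
  rw [inner_gradient, hf.fderiv, h]

/-- Local existence of Lie–Darboux coordinates: `w = cos θ ∇ψ + sin θ ∇ℓ`. -/
theorem exists_beltrami_representation (w : E3 → E3) (hw : ContDiff ℝ ∞ w) (x₀ : E3)
    (h0 : curl w x₀ ≠ 0) :
    ∃ l ψ θ : E3 → ℝ, ContDiff ℝ ∞ l ∧ ContDiff ℝ ∞ ψ ∧ ContDiff ℝ ∞ θ ∧
      Real.sin (θ x₀) ≠ 0 ∧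
      ∀ᶠ x in 𝓝 x₀, w x = Real.cos (θ x) • gradient ψ x + Real.sin (θ x) • gradient l x := by
  obtain ⟨z, L, a, hz, hL, ha, ha0, hw'⟩ := exists_darboux_form w hw x₀ h0
  -- The shift leaves ∇θ unchanged and gives `sin (θ x₀) = 1`.
  set θ : E3 → ℝ := fun x => a x + Real.pi / 2 with hθ
  have hθs : ContDiff ℝ ∞ θ := ha.add contDiff_const
  have hc : ContDiff ℝ ∞ fun x => Real.cos (θ x) := Real.contDiff_cos.comp hθs
  have hs : ContDiff ℝ ∞ fun x => Real.sin (θ x) := Real.contDiff_sin.comp hθs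
  -- This rotation of (L, z) inverts to L = ℓ cos θ - ψ sin θ, the first component of `labels`.
  refine ⟨fun x => L x * Real.cos (θ x) + z x * Real.sin (θ x),
    fun x => z x * Real.cos (θ x) - L x * Real.sin (θ x), θ, (hL.mul hc).add (hz.mul hs),
    (hz.mul hc).sub (hL.mul hs), hθs, by simp [hθ, ha0], ?_⟩
  filter_upwards [hw'] with x hx
  have hzd := (hz.differentiable (by simp) x).hasFDerivAt
  have hLd := (hL.differentiable (by simp) x).hasFDerivAt
  have hθd : HasFDerivAt θ (fderiv ℝ a x) x :=
    (ha.differentiable (by simp) x).hasFDerivAt.add_const _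
  have h1 := gradient_eq_of_hasFDerivAt ((hLd.mul hθd.cos).add (hzd.mul hθd.sin))
    (v := L x • -Real.sin (θ x) • gradient a x + Real.cos (θ x) • gradient L x
      + (z x • Real.cos (θ x) • gradient a x + Real.sin (θ x) • gradient z x)) (fun k => by
      simp only [inner_add_left, real_inner_smul_left, inner_gradient]; simp)
  have h2 := gradient_eq_of_hasFDerivAt ((hzd.mul hθd.cos).sub (hLd.mul hθd.sin))
    (v := z x • -Real.sin (θ x) • gradient a x + Real.cos (θ x) • gradient z x
      - (L x • Real.cos (θ x) • gradient a x + Real.sin (θ x) • gradient L x)) (fun k => by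
      simp only [inner_add_left, inner_sub_left, real_inner_smul_left, inner_gradient]; simp)
  have h1' : gradient (fun x => L x * Real.cos (θ x) + z x * Real.sin (θ x)) x = _ := h1
  have h2' : gradient (fun x => z x * Real.cos (θ x) - L x * Real.sin (θ x)) x = _ := h2
  rw [hx, h1', h2']
  have h3 := Real.sin_sq_add_cos_sq (θ x)
  apply ext_E3 <;> simp only [PiLp.add_apply, PiLp.sub_apply, PiLp.smul_apply, smul_eq_mul]
  · linear_combination (L x * gradient a x 0 - gradient z x 0) * h3
  · linear_combination (L x * gradient a x 1 - gradient z x 1) * h3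
  · linear_combination (L x * gradient a x 2 - gradient z x 2) * h3

end Darboux

/-! ### Linear algebra of the coordinate frame. -/

section BeltramiAlgebra

lemma cross_cross_cyclic (a b c : E3) :
    cross (cross b c) (cross c a) = inner ℝ a (cross b c) • c := by
  apply ext_E3 <;> simp [inner_E3] <;> ring

lemma inner_cross_cyclic (a b c : E3) : inner ℝ b (cross c a) = inner ℝ a (cross b c) := by
  simp only [inner_E3, cross_zero_apply, cross_one_apply, cross_two_apply]
  ring

lemma inner_cross_self_left (a b : E3) : inner ℝ a (cross a b) = 0 := by
  simp only [inner_E3, cross_zero_apply, cross_one_apply, cross_two_apply]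
  ring

lemma inner_cross_self_right (a b : E3) : inner ℝ b (cross a b) = 0 := by
  simp only [inner_E3, cross_zero_apply, cross_one_apply, cross_two_apply]
  ring

lemma jacobian_cyclic (a b c : E3 → ℝ) (x : E3) : jacobian b c a x = jacobian a b c x :=
  inner_cross_cyclic _ _ _

/-- Applied with A = ∇ℓ, B = ∇ψ, C = ∇θ. The terms in α combine to a multiple of s B × C + c C × A,
hence of `h • w`, and disappear from the product; α remains free to adjust the divergence. -/
lemma cross_tangent_combination {w A B C : E3} {h s c α p q J : ℝ}
    (hJ : inner ℝ A (cross B C) = J) (hJ0 : J ≠ 0) (hs : s ≠ 0)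
    (hw : h • w = s • cross B C + c • cross C A) :
    cross w (h • (α • J⁻¹ • cross B C + ((q + α * c) / s) • J⁻¹ • cross C A
      + p • J⁻¹ • cross A B)) = p • (c • A - s • B) + q • C := by
  have h1 : cross (cross B C) (cross C A) = J • C := by rw [cross_cross_cyclic, hJ]
  have h2 : cross (cross C A) (cross A B) = J • A := by
    rw [cross_cross_cyclic, inner_cross_cyclic, hJ]
  have h3 : cross (cross A B) (cross B C) = J • B := by
    rw [cross_cross_cyclic, inner_cross_cyclic, inner_cross_cyclic, hJ]
  have h4 : cross (cross B C) (cross A B) = -(J • B) := by rw [cross_swap, h3]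
  have h5 : cross (cross C A) (cross B C) = -(J • C) := by rw [cross_swap, h1]
  rw [cross_smul_right, ← cross_smul_left, hw]
  simp only [cross_add_left, cross_add_right, cross_smul_left, cross_smul_right, cross_self,
    h1, h2, h4, h5]
  apply ext_E3 <;> simp only [PiLp.add_apply, PiLp.sub_apply, PiLp.neg_apply, PiLp.zero_apply,
    PiLp.smul_apply, smul_eq_mul] <;> field_simp <;> ring

/-- Pairing with the dual frame B × C, C × A, A × B isolates p c, -p s and q. -/
lemma eq_zero_of_combination_eq_zero {A B C : E3} {s c p q : ℝ}
    (hJ0 : inner ℝ A (cross B C) ≠ 0) (hsc : s ^ 2 + c ^ 2 = 1)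
    (h : p • (c • A - s • B) + q • C = 0) : p = 0 ∧ q = 0 := by
  have hA := congrArg (fun v => inner ℝ v (cross B C)) h
  have hB := congrArg (fun v => inner ℝ v (cross C A)) h
  have hC := congrArg (fun v => inner ℝ v (cross A B)) h
  have hJ2 : inner ℝ C (cross A B) = inner ℝ A (cross B C) := by
    rw [inner_cross_cyclic, inner_cross_cyclic]
  simp only [inner_add_left, inner_sub_left, real_inner_smul_left, inner_zero_left,
    inner_cross_self_left, inner_cross_self_right, inner_cross_cyclic A B C, hJ2] at hA hB hC
  have h1 : p * c = 0 := by
    refine (mul_eq_zero.1 ?_).resolve_right hJ0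
    linear_combination hA
  have h2 : p * s = 0 := by
    refine (mul_eq_zero.1 ?_).resolve_right hJ0
    linear_combination -hB
  refine ⟨?_, (mul_eq_zero.1 ?_).resolve_right hJ0⟩
  · linear_combination s * h2 + c * h1 - p * hsc
  · linear_combination hC

end BeltramiAlgebra

/-! ### The symmetry attached to a function of L and θ. -/

section BeltramiCoordinates

variable {w : E3 → E3} {l ψ θ : E3 → ℝ} {g : ℝ × ℝ → ℝ}

lemma curl_of_representation (hl : ContDiff ℝ ∞ l) (hψ : ContDiff ℝ ∞ ψ) (hθ : ContDiff ℝ ∞ θ)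
    {x : E3} (h : w =ᶠ[𝓝 x] fun x =>
      Real.cos (θ x) • gradient ψ x + Real.sin (θ x) • gradient l x) :
    curl w x = Real.sin (θ x) • cross (gradient ψ x) (gradient θ x)
      + Real.cos (θ x) • cross (gradient θ x) (gradient l x) := by
  have hc : ContDiff ℝ ∞ fun x => Real.cos (θ x) := Real.contDiff_cos.comp hθ
  have hs : ContDiff ℝ ∞ fun x => Real.sin (θ x) := Real.contDiff_sin.comp hθ
  have h1 : ContDiff ℝ ∞ fun x => Real.cos (θ x) • gradient ψ x :=
    hc.smul (contDiff_gradient hψ)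
  have h2 : ContDiff ℝ ∞ fun x => Real.sin (θ x) • gradient l x :=
    hs.smul (contDiff_gradient hl)
  have hθd := (hθ.differentiable (by simp) x).hasFDerivAt
  have h3 : gradient (fun x => Real.cos (θ x)) x = -Real.sin (θ x) • gradient θ x :=
    gradient_eq_of_hasFDerivAt hθd.cos fun k => by
      rw [real_inner_smul_left, inner_gradient]; simp
  have h4 : gradient (fun x => Real.sin (θ x)) x = Real.cos (θ x) • gradient θ x :=
    gradient_eq_of_hasFDerivAt hθd.sin fun k => by
      rw [real_inner_smul_left, inner_gradient]; simp
  rw [curl_congr h, curl_add (h1.differentiable (by simp) x) (h2.differentiable (by simp) x),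
    curl_smul_gradient (hc.differentiable (by simp) x) hψ,
    curl_smul_gradient (hs.differentiable (by simp) x) hl, h3, h4, cross_smul_left,
    cross_smul_left, cross_swap (gradient θ x) (gradient ψ x)]
  simp

/-- The cross terms vanish and the remaining two add up by sin² + cos² = 1. For a force-free field
this makes the Jacobian nonzero, so that (ℓ, ψ, θ) are coordinates. -/
lemma inner_curl_of_representation (hl : ContDiff ℝ ∞ l) (hψ : ContDiff ℝ ∞ ψ)
    (hθ : ContDiff ℝ ∞ θ) {x : E3} (h : w =ᶠ[𝓝 x] fun x =>
      Real.cos (θ x) • gradient ψ x + Real.sin (θ x) • gradient l x) :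
    inner ℝ (w x) (curl w x) = jacobian l ψ θ x := by
  rw [curl_of_representation hl hψ hθ h, h.self_of_nhds, jacobian]
  simp only [inner_add_left, inner_add_right, real_inner_smul_left, real_inner_smul_right,
    inner_cross_self_left, inner_cross_self_right,
    inner_cross_cyclic (gradient l x) (gradient ψ x) (gradient θ x)]
  linear_combination inner ℝ (gradient l x) (cross (gradient ψ x) (gradient θ x))
    * Real.sin_sq_add_cos_sq (θ x)

lemma gradient_comp_labels (hl : ContDiff ℝ ∞ l) (hψ : ContDiff ℝ ∞ ψ) (hθ : ContDiff ℝ ∞ θ)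
    (hg : ContDiff ℝ ∞ g) (x : E3) :
    gradient (fun z => g (labels l ψ θ z)) x
      = gL g l ψ θ x • (Real.cos (θ x) • gradient l x - Real.sin (θ x) • gradient ψ x)
        + gTheta g l ψ θ x • gradient θ x := by
  have hld := (hl.differentiable (by simp) x).hasFDerivAt
  have hψd := (hψ.differentiable (by simp) x).hasFDerivAt
  have hθd := (hθ.differentiable (by simp) x).hasFDerivAt
  have h1 := ((hld.mul hθd.cos).sub (hψd.mul hθd.sin)).prodMk hθd
  have h2 := (hg.differentiable (by simp) (labels l ψ θ x)).hasFDerivAt.comp x h1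
  refine gradient_eq_of_hasFDerivAt h2 fun k => ?_
  -- Increments of (L, θ) are split along the two directions that define `gL` and `gTheta`.
  have h3 : ∀ a b : ℝ, (a, b)
      = (a - b * (-(l x * Real.sin (θ x)) - ψ x * Real.cos (θ x))) • ((1 : ℝ), (0 : ℝ))
        + b • (-(l x * Real.sin (θ x)) - ψ x * Real.cos (θ x), (1 : ℝ)) := by
    intro a b
    ext <;> simp
  rw [ContinuousLinearMap.comp_apply, ContinuousLinearMap.prod_apply, h3, map_add, map_smul,
    map_smul]
  simp only [gL, gTheta, inner_add_left, inner_sub_left, real_inner_smul_left, inner_gradient,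
    _root_.sub_apply, _root_.add_apply, _root_.smul_apply, smul_eq_mul]
  ring

lemma gradient_comp_labels_ne_zero (hl : ContDiff ℝ ∞ l) (hψ : ContDiff ℝ ∞ ψ)
    (hθ : ContDiff ℝ ∞ θ) (hg : ContDiff ℝ ∞ g) {x : E3} (hJ : jacobian l ψ θ x ≠ 0)
    (hgx : fderiv ℝ g (labels l ψ θ x) ≠ 0) :
    gradient (fun z => g (labels l ψ θ z)) x ≠ 0 := by
  rw [gradient_comp_labels hl hψ hθ hg]
  intro h
  obtain ⟨h1, h2⟩ := eq_zero_of_combination_eq_zero hJ (Real.sin_sq_add_cos_sq (θ x)) h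
  apply hgx
  rw [gL] at h1
  rw [gTheta] at h2
  have h3 : fderiv ℝ g (labels l ψ θ x) (0, 1) = 0 := by
    have h4 : ((0 : ℝ), (1 : ℝ)) = (-(l x * Real.sin (θ x)) - ψ x * Real.cos (θ x), (1 : ℝ))
        - (-(l x * Real.sin (θ x)) - ψ x * Real.cos (θ x)) • ((1 : ℝ), (0 : ℝ)) := by
      ext <;> simp
    rw [h4, map_sub, map_smul, h1, h2]; simp
  ext
  · simpa using h1
  · simpa using h3

lemma contDiff_jacobian (hl : ContDiff ℝ ∞ l) (hψ : ContDiff ℝ ∞ ψ) (hθ : ContDiff ℝ ∞ θ) :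
    ContDiff ℝ ∞ (jacobian l ψ θ) :=
  (contDiff_gradient hl).inner ℝ (contDiff_cross (contDiff_gradient hψ) (contDiff_gradient hθ))

lemma contDiffAt_tangentVec (hl : ContDiff ℝ ∞ l) (hψ : ContDiff ℝ ∞ ψ) (hθ : ContDiff ℝ ∞ θ)
    {x : E3} (hJ : jacobian l ψ θ x ≠ 0) : ContDiffAt ℝ ∞ (tangentVec l ψ θ) x :=
  ((contDiff_jacobian hl hψ hθ).contDiffAt.inv hJ).smul
    (contDiff_cross (contDiff_gradient hψ) (contDiff_gradient hθ)).contDiffAt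

lemma contDiff_labels (hl : ContDiff ℝ ∞ l) (hψ : ContDiff ℝ ∞ ψ) (hθ : ContDiff ℝ ∞ θ) :
    ContDiff ℝ ∞ (labels l ψ θ) :=
  ((hl.mul (Real.contDiff_cos.comp hθ)).sub (hψ.mul (Real.contDiff_sin.comp hθ))).prodMk hθ

lemma contDiff_gL (hl : ContDiff ℝ ∞ l) (hψ : ContDiff ℝ ∞ ψ) (hθ : ContDiff ℝ ∞ θ)
    (hg : ContDiff ℝ ∞ g) : ContDiff ℝ ∞ (gL g l ψ θ) :=
  (contDiff_fderiv_apply hg (1, 0)).comp (contDiff_labels hl hψ hθ)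

lemma contDiff_gTheta (hl : ContDiff ℝ ∞ l) (hψ : ContDiff ℝ ∞ ψ) (hθ : ContDiff ℝ ∞ θ)
    (hg : ContDiff ℝ ∞ g) : ContDiff ℝ ∞ (gTheta g l ψ θ) :=
  ((contDiff_infty_iff_fderiv.1 hg).2.comp (contDiff_labels hl hψ hθ)).clm_apply
    (((hl.mul (Real.contDiff_sin.comp hθ)).neg.sub
      (hψ.mul (Real.contDiff_cos.comp hθ))).prodMk contDiff_const)

lemma contDiffAt_beltramiCoeff (hw : ContDiff ℝ ∞ w) {x : E3} (hx : w x ≠ 0) :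
    ContDiffAt ℝ ∞ (beltramiCoeff w) x :=
  (hw.inner ℝ (contDiff_curl hw)).contDiffAt.div (hw.norm_sq ℝ).contDiffAt (by simpa using hx)

/-- Near `x₀` a suitable `α` makes `beltramiSymmetry` a solenoidal symmetry of the Beltrami
field `w`. -/
theorem exists_beltramiSymmetry (hw : ContDiff ℝ ∞ w) (hl : ContDiff ℝ ∞ l)
    (hψ : ContDiff ℝ ∞ ψ) (hθ : ContDiff ℝ ∞ θ) (hg : ContDiff ℝ ∞ g) {x₀ : E3}
    (hw0 : w x₀ ≠ 0) (hdiv : ∀ᶠ x in 𝓝 x₀, div w x = 0)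
    (hrep : ∀ᶠ x in 𝓝 x₀,
      w x = Real.cos (θ x) • gradient ψ x + Real.sin (θ x) • gradient l x)
    (hcurl : ∀ᶠ x in 𝓝 x₀, curl w x = beltramiCoeff w x • w x)
    (hs0 : Real.sin (θ x₀) ≠ 0) (hJ0 : jacobian l ψ θ x₀ ≠ 0) :
    ∃ α : E3 → ℝ, ∀ᶠ x in 𝓝 x₀, ContDiffAt ℝ ∞ α x ∧
      ContDiffAt ℝ ∞ (beltramiSymmetry w l ψ θ g α) x ∧
      VectorField.lieBracket ℝ (beltramiSymmetry w l ψ θ g α) w x = 0 ∧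
      div (beltramiSymmetry w l ψ θ g α) x = 0 ∧
      cross (w x) (beltramiSymmetry w l ψ θ g α x)
        = gradient (fun z => g (labels l ψ θ z)) x := by
  have hs : ContDiff ℝ ∞ fun x => Real.sin (θ x) := Real.contDiff_sin.comp hθ
  have hJs := contDiff_jacobian hl hψ hθ
  have hwne : ∀ᶠ x in 𝓝 x₀, w x ≠ 0 := hw.continuous.continuousAt.eventually_ne hw0
  have hsne : ∀ᶠ x in 𝓝 x₀, Real.sin (θ x) ≠ 0 :=
    hs.continuous.continuousAt.eventually_ne hs0
  have hJne : ∀ᶠ x in 𝓝 x₀, jacobian l ψ θ x ≠ 0 :=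
    hJs.continuous.continuousAt.eventually_ne hJ0
  have hJh : ∀ᶠ x in 𝓝 x₀, jacobian l ψ θ x = beltramiCoeff w x * ‖w x‖ ^ 2 := by
    filter_upwards [hrep.eventually_nhds, hwne] with x h1 h2
    rw [← inner_curl_of_representation hl hψ hθ h1, beltramiCoeff, div_mul_cancel₀]
    simpa using h2
  have hhne : ∀ᶠ x in 𝓝 x₀, beltramiCoeff w x ≠ 0 := by
    filter_upwards [hJne, hJh] with x h1 h2 h3
    rw [h3, zero_mul] at h2
    exact h1 h2
  have hhw : ∀ᶠ x in 𝓝 x₀, beltramiCoeff w x • w x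
      = Real.sin (θ x) • cross (gradient ψ x) (gradient θ x)
        + Real.cos (θ x) • cross (gradient θ x) (gradient l x) := by
    filter_upwards [hrep.eventually_nhds, hcurl] with x h1 h2
    rw [← h2, curl_of_representation hl hψ hθ h1]
  -- `R` is a globally smooth representative of the part of ξ that does not involve α.
  obtain ⟨R, hR, hRR⟩ := exists_contDiff_eventuallyEq (x := x₀) (f := fun x =>
      beltramiCoeff w x • ((gTheta g l ψ θ x / Real.sin (θ x)) • tangentVec ψ θ l x
        + gL g l ψ θ x • tangentVec θ l ψ x)) (by
    filter_upwards [hwne, hsne, hJne] with x h1 h2 h3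
    refine (contDiffAt_beltramiCoeff hw h1).smul ((ContDiffAt.smul
      ((contDiff_gTheta hl hψ hθ hg).contDiffAt.div hs.contDiffAt h2)
      (contDiffAt_tangentVec hψ hθ hl ?_)).add
      ((contDiff_gL hl hψ hθ hg).contDiffAt.smul (contDiffAt_tangentVec hθ hl hψ ?_)))
    · rwa [jacobian_cyclic]
    · rwa [jacobian_cyclic, jacobian_cyclic])
  -- As div w = 0, this equation for β says div (β w + R) = 0.
  obtain ⟨β, hβ, hβw⟩ := exists_transport_solution w hw x₀ hw0 (fun x => -div R x)
    (contDiff_div hR).neg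
  have hβws : ContDiff ℝ ∞ fun x => β x • w x := hβ.smul hw
  have hξs : ContDiff ℝ ∞ fun x => β x • w x + R x := hβws.add hR
  -- From ĥ w = J (sin θ ∂_ℓ + cos θ ∂_ψ) and J = ĥ |w|², this is the α whose contribution to ξ
  -- equals β w.
  set α : E3 → ℝ := fun x => β x * ‖w x‖ ^ 2 * Real.sin (θ x) / beltramiCoeff w x with hα
  have hξ : beltramiSymmetry w l ψ θ g α =ᶠ[𝓝 x₀] fun x => β x • w x + R x := by
    filter_upwards [hRR, hJh, hJne, hsne, hhne, hhw] with x h1 h2 h3 h4 h5 h6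
    have h7 : w x = (beltramiCoeff w x)⁻¹ •
        (Real.sin (θ x) • cross (gradient ψ x) (gradient θ x)
        + Real.cos (θ x) • cross (gradient θ x) (gradient l x)) := by
      rw [← h6, smul_smul, inv_mul_cancel₀ h5, one_smul]
    have h8 : α x * beltramiCoeff w x ^ 2 = β x * jacobian l ψ θ x * Real.sin (θ x) := by
      rw [hα, h2]; field_simp
    have h9 : α x = β x * jacobian l ψ θ x * Real.sin (θ x) / beltramiCoeff w x ^ 2 := by
      rw [← h8]; field_simp
    rw [h1]
    conv_rhs => rw [h7]
    simp only [beltramiSymmetry, h9, tangentVec, jacobian_cyclic l ψ θ, jacobian_cyclic ψ θ l]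
    apply ext_E3 <;> simp only [PiLp.add_apply, PiLp.smul_apply, smul_eq_mul] <;> field_simp <;>
      ring
  have hdivξ : ∀ᶠ x in 𝓝 x₀, div (fun x => β x • w x + R x) x = 0 := by
    filter_upwards [hβw, hdiv] with x h1 h2
    rw [div_add (hβws.differentiable (by simp) x) (hR.differentiable (by simp) x),
      div_smul (hβ.differentiable (by simp) x) (hw.differentiable (by simp) x), h1, h2]
    ring
  have hcross : ∀ᶠ x in 𝓝 x₀, cross (w x) (beltramiSymmetry w l ψ θ g α x)
      = gradient (fun z => g (labels l ψ θ z)) x := by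
    filter_upwards [hJne, hsne, hhw] with x h1 h2 h3
    rw [gradient_comp_labels hl hψ hθ hg]
    simp only [beltramiSymmetry, tangentVec, jacobian_cyclic l ψ θ, jacobian_cyclic ψ θ l]
    exact cross_tangent_combination rfl h1 h2 h3
  refine ⟨α, ?_⟩
  filter_upwards [hwne, hhne, hξ.eventually_nhds, hdivξ, hdiv, hcross, hcross.eventually_nhds]
    with x h1 h2 h3 h4 h5 h6 h7
  refine ⟨?_, ?_, ?_, ?_, h6⟩
  · exact ((hβ.mul (hw.norm_sq ℝ)).mul hs).contDiffAt.div (contDiffAt_beltramiCoeff hw h1) h2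
  · exact hξs.contDiffAt.congr_of_eventuallyEq h3
  · rw [Filter.EventuallyEq.lieBracket_vectorField_eq h3 Filter.EventuallyEq.rfl]
    refine lieBracket_eq_zero_of_cross_eq_gradient (b := fun x => β x • w x + R x)
      (g := fun z => g (labels l ψ θ z)) (hw.differentiable (by simp) x)
      (hξs.differentiable (by simp) x) (hg.comp (contDiff_labels hl hψ hθ)) h5 h4 ?_
    filter_upwards [h3, h7] with y h8 h9
    rw [← h9, h8]
  · rw [div_congr h3, h4]

end BeltramiCoordinates

/-! ### Symmetries of solutions, in general and near force-free points. -/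

section Main

variable {Ω : Set E3} {w : E3 → E3} {χ : E3 → ℝ}

/-- A triple of smooth functions with nonvanishing Jacobian is locally injective. -/
lemma exists_injOn_of_jacobian_ne_zero {l ψ θ : E3 → ℝ} (hl : ContDiff ℝ ∞ l)
    (hψ : ContDiff ℝ ∞ ψ) (hθ : ContDiff ℝ ∞ θ) {x₀ : E3} (hJ : jacobian l ψ θ x₀ ≠ 0) :
    ∃ N ∈ 𝓝 x₀, Set.InjOn (fun x => (l x, ψ x, θ x)) N := by
  let Φ : E3 → E3 := fun x => !₂[l x, ψ x, θ x]
  have hΦ : ContDiff ℝ ∞ Φ := contDiff_E3 hl hψ hθ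
  have hΦd := hΦ.differentiable (by simp) x₀
  have hcoord : ∀ v, inner ℝ (gradient l x₀) v = fderiv ℝ Φ x₀ v 0 ∧
      inner ℝ (gradient ψ x₀) v = fderiv ℝ Φ x₀ v 1 ∧
      inner ℝ (gradient θ x₀) v = fderiv ℝ Φ x₀ v 2 := by
    intro v
    simp only [inner_gradient, ← fderiv_coord hΦd]
    exact ⟨rfl, rfl, rfl⟩
  have hinj : Function.Injective (fderiv ℝ Φ x₀ : E3 →ₗ[ℝ] E3) := by
    rw [← LinearMap.ker_eq_bot, LinearMap.ker_eq_bot']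
    intro v hv
    have hv' : fderiv ℝ Φ x₀ v = 0 := hv
    obtain ⟨h0, h1, h2⟩ := hcoord v
    rw [hv'] at h0 h1 h2
    -- A nonzero kernel vector is orthogonal to ∇ψ and ∇θ, so ∇ψ × ∇θ is a multiple of it. It is
    -- also orthogonal to ∇ℓ, so the Jacobian would vanish.
    have h3 := cross_cross_eq_zero h1 h2
    by_contra hne
    have hc : cross v (cross (gradient ψ x₀) (gradient θ x₀)) = 0 := by
      rw [cross_swap, h3, neg_zero]
    apply hJ
    rw [jacobian, eq_smul_of_cross_eq_zero hne hc, real_inner_smul_right, h0]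
    simp
  let A : E3 ≃L[ℝ] E3 :=
    (LinearEquiv.ofInjectiveEndo (fderiv ℝ Φ x₀ : E3 →ₗ[ℝ] E3) hinj).toContinuousLinearEquiv
  have hA : HasFDerivAt Φ (A : E3 →L[ℝ] E3) x₀ :=
    hΦd.hasFDerivAt.congr_fderiv (by ext1 v; rfl)
  obtain ⟨g, -, -, hg, -⟩ := exists_smooth_localInverse Φ hΦ x₀ A hA
  refine ⟨_, hg, fun x hx y hy hxy => ?_⟩
  simp only [Prod.mk.injEq] at hxy
  have : Φ x = Φ y := ext_E3 hxy.1 hxy.2.1 hxy.2.2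
  rw [← show g (Φ x) = x from hx, ← show g (Φ y) = y from hy, this]

lemma exists_smooth_extension (hΩ : IsOpen Ω) (hw : ContDiffOn ℝ ∞ w Ω) {x : E3} (hx : x ∈ Ω) :
    ∃ v : E3 → E3, ContDiff ℝ ∞ v ∧ v =ᶠ[𝓝 x] w :=
  exists_contDiff_eventuallyEq <| by
    filter_upwards [hΩ.mem_nhds hx] with y hy using hw.contDiffAt (hΩ.mem_nhds hy)

/-- The curl of a solution is a solenoidal symmetry. -/
theorem isSolenoidalSymmetryOn_curl (hΩ : IsOpen Ω) (hw : ContDiffOn ℝ ∞ w Ω)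
    (hsol : SolvesMFF Ω w χ) : IsSolenoidalSymmetryOn Ω (curl w) w := by
  have key : ∀ x ∈ Ω, ContDiffAt ℝ ∞ (curl w) x ∧
      VectorField.lieBracket ℝ (curl w) w x = 0 ∧ div (curl w) x = 0 := by
    intro x hx
    obtain ⟨v, hv, hvw⟩ := exists_smooth_extension hΩ hw hx
    have hcv : curl v =ᶠ[𝓝 x] curl w := by
      filter_upwards [hvw.eventuallyEq_nhds] with y hy using curl_congr hy
    have hcs := contDiff_curl hv
    have hfb : ∀ᶠ y in 𝓝 x, cross (v y) (curl v y) = gradient χ y := by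
      filter_upwards [hvw, hcv, hΩ.mem_nhds hx] with y h1 h2 h3
      rw [h1, h2, hsol.force_balance y h3]
    -- χ is assumed only C¹, but its gradient is the smooth field w × curl w, so χ is smooth near
    -- the point.
    obtain ⟨p, hp, hpχ⟩ := exists_contDiff_of_gradient (x₀ := x) (z := χ)
        (contDiff_cross hv hcs) (by
      filter_upwards [hfb, hΩ.mem_nhds hx] with y h1 h2
      rw [h1]
      have h3 : DifferentiableAt ℝ χ y :=
        (hsol.contDiffOn_pressure.contDiffAt (hΩ.mem_nhds h2)).differentiableAt one_ne_zero
      exact h3.hasGradientAt)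
    refine ⟨hcs.contDiffAt.congr_of_eventuallyEq hcv.symm, ?_, ?_⟩
    · rw [← hcv.lieBracket_vectorField_eq hvw]
      refine lieBracket_eq_zero_of_cross_eq_gradient (hv.differentiable (by simp) x)
        (hcs.differentiable (by simp) x) hp ?_ (div_curl hv x) ?_
      · rw [div_congr hvw, hsol.solenoidal x hx]
      · filter_upwards [hfb, hpχ.gradient] with y h1 h2
        rw [h1, h2]
    · rw [← div_congr hcv, div_curl hv]
  exact ⟨⟨fun x hx => (key x hx).1.contDiffWithinAt, fun x hx => (key x hx).2.1⟩,
    fun x hx => (key x hx).2.2⟩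

lemma beltramiCoeff_congr {v : E3 → E3} {x : E3} (h : v =ᶠ[𝓝 x] w) :
    beltramiCoeff v x = beltramiCoeff w x := by
  rw [beltramiCoeff, beltramiCoeff, curl_congr h, h.eq_of_nhds]

lemma curl_eq_beltramiCoeff_smul {x : E3} (hx : w x ≠ 0) (h : cross (w x) (curl w x) = 0) :
    curl w x = beltramiCoeff w x • w x := by
  rw [beltramiCoeff, ← real_inner_self_eq_norm_sq]
  exact eq_smul_of_cross_eq_zero hx h

/-- Beltrami coordinates and the associated symmetries near a point where the field is
force-free. -/
theorem exists_beltramiCoord (hΩ : IsOpen Ω) (hw : ContDiffOn ℝ ∞ w Ω)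
    (hsol : SolvesMFF Ω w χ) (hw0 : ∀ x ∈ Ω, w x ≠ 0) (hcurl0 : ∀ x ∈ Ω, curl w x ≠ 0)
    {x : E3} (hx : x ∈ Ω) (hχ : ∀ᶠ y in 𝓝 x, gradient χ y = 0) :
    ∃ U : Set E3, IsOpen U ∧ x ∈ U ∧ U ⊆ Ω ∧
      (∀ y ∈ U, curl w y = beltramiCoeff w y • w y) ∧
      ∃ l ψ θ : E3 → ℝ, IsBeltramiCoord U w l ψ θ ∧ (∀ y ∈ U, Real.sin (θ y) ≠ 0) ∧
        ∀ g : ℝ × ℝ → ℝ, ContDiff ℝ ∞ g →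
          ∃ V : Set E3, IsOpen V ∧ x ∈ V ∧ V ⊆ U ∧
          ∃ α : E3 → ℝ, ContDiffOn ℝ ∞ α V ∧
            IsSolenoidalSymmetryOn V (beltramiSymmetry w l ψ θ g α) w ∧
            (∀ y ∈ V, cross (w y) (beltramiSymmetry w l ψ θ g α y)
              = gradient (fun z => g (labels l ψ θ z)) y) ∧
            (fderiv ℝ g (labels l ψ θ x) ≠ 0 → ∀ y ∈ V,
              cross (w y) (beltramiSymmetry w l ψ θ g α y) ≠ 0) := by
  obtain ⟨v, hv, hvw⟩ := exists_smooth_extension hΩ hw hx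
  have hΩx : ∀ᶠ y in 𝓝 x, y ∈ Ω := hΩ.eventually_mem hx
  have hvw' := hvw.eventuallyEq_nhds
  have hwcurl : ∀ᶠ y in 𝓝 x, curl w y = beltramiCoeff w y • w y := by
    filter_upwards [hΩx, hχ] with y h1 h2
    exact curl_eq_beltramiCoeff_smul (hw0 y h1) ((hsol.force_balance y h1).trans h2)
  have hvcurl : ∀ᶠ y in 𝓝 x, curl v y = beltramiCoeff v y • v y := by
    filter_upwards [hwcurl, hvw'] with y h1 h2
    rw [curl_congr h2, beltramiCoeff_congr h2, h2.eq_of_nhds, h1]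
  have hvdiv : ∀ᶠ y in 𝓝 x, div v y = 0 := by
    filter_upwards [hvw', hΩx] with y h1 h2
    rw [div_congr h1, hsol.solenoidal y h2]
  have hvx : v x ≠ 0 := by rw [hvw.eq_of_nhds]; exact hw0 x hx
  have hcx : curl v x ≠ 0 := by rw [curl_congr hvw]; exact hcurl0 x hx
  obtain ⟨l, ψ, θ, hl, hψ, hθ, hs0, hrep⟩ := exists_beltrami_representation v hv x hcx
  -- The Jacobian is w · curl w = ĥ |w|², and ĥ = 0 would force curl w = 0.
  have hJ0 : jacobian l ψ θ x ≠ 0 := by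
    rw [← inner_curl_of_representation hl hψ hθ hrep, hvcurl.self_of_nhds, real_inner_smul_right]
    refine mul_ne_zero (fun h => hcx ?_) (inner_self_ne_zero_E3 hvx)
    rw [hvcurl.self_of_nhds, h, zero_smul]
  have hs : ContDiff ℝ ∞ fun x => Real.sin (θ x) := Real.contDiff_sin.comp hθ
  have hsne : ∀ᶠ y in 𝓝 x, Real.sin (θ y) ≠ 0 := hs.continuous.continuousAt.eventually_ne hs0
  have hJne : ∀ᶠ y in 𝓝 x, jacobian l ψ θ y ≠ 0 :=
    (contDiff_jacobian hl hψ hθ).continuous.continuousAt.eventually_ne hJ0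
  obtain ⟨N, hN, hinj⟩ := exists_injOn_of_jacobian_ne_zero hl hψ hθ hJ0
  obtain ⟨U, hU, hUo, hxU⟩ := eventually_nhds_iff.1
    (hΩx.and (hwcurl.and (hrep.and (hvw.and (hsne.and
      (hJne.and (Filter.eventually_mem_set.2 hN)))))))
  refine ⟨U, hUo, hxU, fun y hy => (hU y hy).1, fun y hy => (hU y hy).2.1, l, ψ, θ,
    ⟨⟨hl.contDiffOn, hψ.contDiffOn, hθ.contDiffOn,
      hinj.mono fun y hy => (hU y hy).2.2.2.2.2.2, fun y hy => (hU y hy).2.2.2.2.2.1⟩,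
      fun y hy => ?_⟩, fun y hy => (hU y hy).2.2.2.2.1, fun g hg => ?_⟩
  · rw [← (hU y hy).2.2.1, (hU y hy).2.2.2.1]
  obtain ⟨α, hα⟩ := exists_beltramiSymmetry hv hl hψ hθ hg hvx hvdiv hrep hvcurl hs0 hJ0
  have hξ : ∀ᶠ y in 𝓝 x, beltramiSymmetry v l ψ θ g α =ᶠ[𝓝 y] beltramiSymmetry w l ψ θ g α := by
    filter_upwards [hvw'.eventually_nhds] with y h1
    filter_upwards [h1] with z h2
    simp only [beltramiSymmetry, beltramiCoeff_congr h2]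
  -- Keeping the hypothesis on `g` inside the implication lets a single `V` and α serve whether or
  -- not the differential vanishes at `x`.
  have hgne : ∀ᶠ y in 𝓝 x, fderiv ℝ g (labels l ψ θ x) ≠ 0 → fderiv ℝ g (labels l ψ θ y) ≠ 0 := by
    by_cases h : fderiv ℝ g (labels l ψ θ x) = 0
    · exact Filter.Eventually.of_forall fun _ h1 => absurd h h1
    · have hc : Continuous fun y => fderiv ℝ g (labels l ψ θ y) :=
        (hg.continuous_fderiv (by simp)).comp (contDiff_labels hl hψ hθ).continuous
      filter_upwards [hc.continuousAt.eventually_ne h] with y hy _ using hy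
  obtain ⟨V, hV, hVo, hxV⟩ := eventually_nhds_iff.1
    ((hUo.eventually_mem hxU).and (hα.and (hξ.and (hvw'.and hgne))))
  have hcross : ∀ y ∈ V, cross (w y) (beltramiSymmetry w l ψ θ g α y)
      = gradient (fun z => g (labels l ψ θ z)) y := by
    intro y hy
    obtain ⟨-, ⟨-, -, -, -, h⟩, hξy, hvy, -⟩ := hV y hy
    rw [← h, hξy.eq_of_nhds, hvy.eq_of_nhds]
  refine ⟨V, hVo, hxV, fun y hy => (hV y hy).1, α,
    fun y hy => (hV y hy).2.1.1.contDiffWithinAt, ⟨⟨fun y hy => ?_, fun y hy => ?_⟩,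
      fun y hy => ?_⟩, hcross, fun h y hy => ?_⟩
  · obtain ⟨-, ⟨-, h, -⟩, hξy, -⟩ := hV y hy
    exact (h.congr_of_eventuallyEq hξy.symm).contDiffWithinAt
  · obtain ⟨-, ⟨-, -, h, -⟩, hξy, hvy, -⟩ := hV y hy
    rw [← hξy.lieBracket_vectorField_eq hvy, h]
  · obtain ⟨-, ⟨-, -, -, h, -⟩, hξy, -⟩ := hV y hy
    rw [← div_congr hξy, h]
  · obtain ⟨hyU, -, -, -, hgy⟩ := hV y hy
    rw [hcross y hy]
    exact gradient_comp_labels_ne_zero hl hψ hθ hg (hU y hyU).2.2.2.2.2.1 (hgy h)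

end Main

end Magnetofluid

end

theorem proposition1 (Ω : Set Magnetofluid.E3) (hΩ : IsOpen Ω)
    (w : Magnetofluid.E3 → Magnetofluid.E3) (χ : Magnetofluid.E3 → ℝ)
    (hw : ContDiffOn ℝ ∞ w Ω) (hsol : Magnetofluid.SolvesMFF Ω w χ)
    (hw0 : ∀ x ∈ Ω, w x ≠ 0) (hcurl0 : ∀ x ∈ Ω, Magnetofluid.curl w x ≠ 0) :
    -- every point has a neighbourhood with a nontrivial solenoidal symmetry
    (∀ x ∈ Ω, ∃ U : Set Magnetofluid.E3, IsOpen U ∧ x ∈ U ∧ U ⊆ Ω ∧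
      ∃ ξ : Magnetofluid.E3 → Magnetofluid.E3,
        Magnetofluid.IsSolenoidalSymmetryOn U ξ w ∧
        (∀ y ∈ U, ξ y ≠ 0) ∧
        x ∈ closure {y ∈ U | Magnetofluid.cross (w y) (ξ y) ≠ 0}) ∧
    -- near points where the field is force-free
    (∀ x ∈ Ω, (∀ᶠ y in 𝓝 x, gradient χ y = 0) →
      ∃ U : Set Magnetofluid.E3, IsOpen U ∧ x ∈ U ∧ U ⊆ Ω ∧
        (∀ y ∈ U, Magnetofluid.curl w y = Magnetofluid.beltramiCoeff w y • w y) ∧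
        ∃ l ψ θ : Magnetofluid.E3 → ℝ,
          Magnetofluid.IsBeltramiCoord U w l ψ θ ∧
          (∀ y ∈ U, Real.sin (θ y) ≠ 0) ∧
          ∀ g : ℝ × ℝ → ℝ, ContDiff ℝ ∞ g →
            ∃ V : Set Magnetofluid.E3, IsOpen V ∧ x ∈ V ∧ V ⊆ U ∧
            ∃ α : Magnetofluid.E3 → ℝ, ContDiffOn ℝ ∞ α V ∧
              Magnetofluid.IsSolenoidalSymmetryOn V
                (Magnetofluid.beltramiSymmetry w l ψ θ g α) w ∧
              (∀ y ∈ V,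
                Magnetofluid.cross (w y) (Magnetofluid.beltramiSymmetry w l ψ θ g α y)
                  = gradient (fun z => g (Magnetofluid.labels l ψ θ z)) y) ∧
              (fderiv ℝ g (Magnetofluid.labels l ψ θ x) ≠ 0 → ∀ y ∈ V,
                Magnetofluid.cross (w y) (Magnetofluid.beltramiSymmetry w l ψ θ g α y) ≠ 0)) ∧
    -- the field `curl w` is a solenoidal symmetry, not aligned with `w` where `∇χ ≠ 0`
    (Magnetofluid.IsSolenoidalSymmetryOn Ω (Magnetofluid.curl w) w ∧
      ∀ y ∈ Ω, gradient χ y ≠ 0 → Magnetofluid.cross (w y) (Magnetofluid.curl w y) ≠ 0) := by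
  have hcurl := Magnetofluid.isSolenoidalSymmetryOn_curl hΩ hw hsol
  have hcross : ∀ y ∈ Ω, gradient χ y ≠ 0 →
      Magnetofluid.cross (w y) (Magnetofluid.curl w y) ≠ 0 := fun y hy h => by
    rwa [hsol.force_balance y hy]
  refine ⟨fun x hx => ?_, fun x hx hχ =>
    Magnetofluid.exists_beltramiCoord hΩ hw hsol hw0 hcurl0 hx hχ, hcurl, hcross⟩
  by_cases hfree : ∀ᶠ y in 𝓝 x, gradient χ y = 0
  · obtain ⟨U, -, -, hUΩ, -, l, ψ, θ, -, -, hsymm⟩ :=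
      Magnetofluid.exists_beltramiCoord hΩ hw hsol hw0 hcurl0 hx hfree
    -- The choice g(L, θ) = L has a differential that vanishes nowhere.
    obtain ⟨V, hVo, hxV, hVU, α, -, hξ, -, hne⟩ := hsymm Prod.fst contDiff_fst
    have hne := hne fun h => by
      have h1 := congrArg (fun A : ℝ × ℝ →L[ℝ] ℝ => A (1, 0)) h
      simp [fderiv_fst] at h1
    refine ⟨V, hVo, hxV, hVU.trans hUΩ, _, hξ, fun y hy h0 => hne y hy ?_,
      subset_closure ⟨hxV, hne x hxV⟩⟩
    rw [h0]
    apply Magnetofluid.ext_E3 <;> simp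
  -- Otherwise points with ∇χ ≠ 0 accumulate at `x`, possibly without ∇χ ≠ 0 at `x` itself; curl w
  -- then works on all of Ω.
  · refine ⟨Ω, hΩ, hx, subset_rfl, _, hcurl, hcurl0, ?_⟩
    rw [mem_closure_iff_frequently]
    refine ((Filter.not_eventually.1 hfree).and_eventually (hΩ.eventually_mem hx)).mono ?_
    exact fun y hy => ⟨hy.2, hcross y hy.2 hy.1⟩
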